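/- Let $\mathcal H$, $\mathcal K$ be separable complex Hilbert spaces, $H_0$ a self-adjoint operator in $\mathcal H$, $G:\mathcal H\to\mathcal K$ a linear operator and $J$ an operator in $\mathcal K$ such that $$\operatorname{Dom}(|H_0|+I)^{1/2}\subset\operatorname{Dom}G,\quad G(|H_0|+I)^{-1/2}\ \text{is compact},\quad J=J^*\ \text{is bounded},\quad 0\in\rho(J).$$ For $z\in\mathbb C\setminus\mathbb R$ put $$T(z)=\bigl(G(|H_0|+I)^{-1/2}\bigr)\frac{|H_0|+I}{H_0-zI}\bigl(G(|H_0|+I)^{-1/2}\bigr)^*,\qquad B(z)=\operatorname{Im}T(z)=\frac{T(z)-T(z)^*}{2i}.$$ Let $H=H(H_0,G,J)$ be the unique self-adjoint operator in $\mathcal H$ such that for all $z\in\mathbb C\setminus\mathbb R$ $$(H-zI)^{-1}-(H_0-zI)^{-1}=-\bigl(G(H_0-\overline zI)^{-1}\bigr)^*(I+JT(z))^{-1}\bigl(JG(H_0-zI)^{-1}\bigr),$$ and put $$M(z;H,H_0)=\bigl(I+(z-\overline z)(H-zI)^{-1}\bigr)\bigl(I+(\overline z-z)(H_0-\overline zI)^{-1}\bigr),$$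 $$S(z;H_0,G,J)=I-2iB^{1/2}(z)(J^{-1}+T(z))^{-1}B^{1/2}(z),$$ where for $\operatorname{Im}z<0$ (when $B(z)\le0$) the square root is $B^{1/2}(z)=i|B(z)|^{1/2}$. For a Hilbert space $E$ let $Y_\infty(E)$ be the set of unitary operators $W$ in $E$ such that $W-I$ is compact. For $W\in Y_\infty(E)$ with spectral projections $E_W(\cdot)$ and $\theta_1,\theta_2\in(0,2\pi)$ let $N(e^{i\theta_1},e^{i\theta_2};W)$ be equal to $\operatorname{rank}E_W([e^{i\theta_1},e^{i\theta_2}))$ if $\theta_1<\theta_2$, to $0$ if $\theta_1=\theta_2$, and to $-\operatorname{rank}E_W([e^{i\theta_2},e^{i\theta_1}))$ if $\theta_2<\theta_1$. Let $X_\infty$ be the set of functions $f:\mathbb T\setminus\{1\}\to\mathbb Z$ for which $\theta\mapsto f(e^{i\theta})$ is left continuous and non-increasing on $(0,2\pi)$, modulo additive integer constants, and let $\eta_\infty(W)\in X_\infty$ be the class of $N(\cdot,z_0;W)$, which does not depend on $z_0\in\mathbb T\setminus\{1\}$. Thus $\eta_\infty(W)$ describes the eigenvalues of $W$ different from $1$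 together with their multiplicities. Theorem. For any $z\in\mathbb C\setminus\mathbb R$ the operator $M(z;H,H_0)-I$ is compact, $M(z;H,H_0)\in Y_\infty(\mathcal H)$, $S(z;H_0,G,J)\in Y_\infty(\mathcal K)$, and $$\eta_\infty(M(z;H,H_0))=\eta_\infty(S(z;H_0,G,J)).$$ -/

import Mathlib

noncomputable section

namespace SpecFlow

open Complex Topology

/-! ### Spectra of unitary operators which differ from the identity by a compact operator -/

/-- The set `Y_∞(E)` of all unitary operators `W` in `E` such that `W - I` is compact. -/
def YInf (E : Type*) [NormedAddCommGroup E] [InnerProductSpace ℂ E] [CompleteSpace E] :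
    Set (E →L[ℂ] E) :=
  {W | W ∈ unitary (E →L[ℂ] E) ∧ IsCompactOperator (W - 1 : E →L[ℂ] E)}

/-- The half-open arc `[e^{ia}, e^{ib})` of the unit circle. -/
def arc (a b : ℝ) : Set ℂ := (fun θ : ℝ => Complex.exp (θ * I)) '' Set.Ico a b

/-- The spectral projection `E_W(s)`, where `s` is such that its indicator function is continuous
on the spectrum of the normal operator `W`.  For `W ∈ Y_∞` this is the case for every arc `s` whose
closure does not contain `1`, see `continuousOn_indicator_arc`. -/
def specProj {E : Type*} [NormedAddCommGroup E] [InnerProductSpace ℂ E] [CompleteSpace E]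
    (W : E →L[ℂ] E) (s : Set ℂ) : E →L[ℂ] E :=
  cfc (s.indicator 1) W

/-- `rank E_W([e^{ia}, e^{ib}))`; it is finite for `W ∈ Y_∞` and `0 < a`, `b < 2π`,
see `finiteDimensional_range_specProj`. -/
def arcRank {E : Type*} [NormedAddCommGroup E] [InnerProductSpace ℂ E] [CompleteSpace E]
    (W : E →L[ℂ] E) (a b : ℝ) : ℕ :=
  Module.finrank ℂ (LinearMap.range (specProj W (arc a b) : E →ₗ[ℂ] E))

/-- The counting function `N(e^{iθ₁}, e^{iθ₂}; W)`, `θ₁, θ₂ ∈ (0, 2π)`. -/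
def countN {E : Type*} [NormedAddCommGroup E] [InnerProductSpace ℂ E] [CompleteSpace E]
    (W : E →L[ℂ] E) (θ₁ θ₂ : ℝ) : ℤ :=
  if θ₁ < θ₂ then arcRank W θ₁ θ₂ else if θ₂ < θ₁ then -arcRank W θ₂ θ₁ else 0

section facts

variable {E : Type*} [NormedAddCommGroup E] [InnerProductSpace ℂ E] [CompleteSpace E]

theorem exists_eigenvector {W : E →L[ℂ] E} (hW : W ∈ YInf E) {u : ℂ} (hu : u ∈ spectrum ℂ W)
    (h1 : u ≠ 1) : ∃ e : E, ‖e‖ = 1 ∧ W e = u • e := by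
  have h : u - 1 ∈ spectrum ℂ (W - 1) := by
    have := (spectrum.add_mem_add_iff (R := ℂ) (a := W - 1) (r := u - 1) (s := 1))
    simp only [map_one, sub_add_cancel, add_sub_cancel] at this
    exact this.1 hu
  obtain ⟨v, hv⟩ :=
    ((hW.2.hasEigenvalue_iff_mem_spectrum (sub_ne_zero.2 h1)).2 h).exists_hasEigenvector
  have hv0 : v ≠ 0 := hv.2
  have hv1 : W v = u • v := by
    have := hv.apply_eq_smul
    simp only [ContinuousLinearMap.coe_coe, sub_apply,
      one_apply_eq_self, sub_smul, one_smul] at this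
    simpa using this
  refine ⟨(‖v‖⁻¹ : ℂ) • v, ?_, ?_⟩
  · rw [norm_smul]; simp [hv0]
  · rw [map_smul, hv1, smul_comm]

theorem inner_eigenvectors {W : E →L[ℂ] E} (hW : W ∈ YInf E) {u v : ℂ} (hu : ‖u‖ = 1)
    (huv : u ≠ v) {e f : E} (he : W e = u • e) (hf : W f = v • f) : inner ℂ e f = 0 := by
  have h1 : inner ℂ (W e) (W f) = inner ℂ e f := by
    rw [← ContinuousLinearMap.adjoint_inner_right, ← ContinuousLinearMap.star_eq_adjoint,
      ← mul_apply_eq_comp, (Unitary.mem_iff.1 hW.1).1, one_apply_eq_self]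
  rw [he, hf, inner_smul_left, inner_smul_right] at h1
  by_contra h0
  have h2 : (starRingEnd ℂ) u * v = 1 := by
    have : ((starRingEnd ℂ) u * v) * inner ℂ e f = 1 * inner ℂ e f := by
      rw [one_mul, mul_assoc, h1]
    exact mul_right_cancel₀ h0 this
  apply huv
  have h3 : u * (starRingEnd ℂ) u = 1 := by
    rw [Complex.mul_conj, Complex.normSq_eq_norm_sq, hu]; simp
  calc u = u * ((starRingEnd ℂ) u * v) := by rw [h2, mul_one]
    _ = v := by rw [← mul_assoc, h3, one_mul]

/-- The spectrum of `W ∈ Y_∞` can accumulate only at `1`. -/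
theorem finite_spectrum {W : E →L[ℂ] E} (hW : W ∈ YInf E) {ε : ℝ} (hε : 0 < ε) :
    (spectrum ℂ W ∩ {u | ε ≤ ‖u - 1‖}).Finite := by
  by_contra hinf
  let f := Set.Infinite.natEmbedding _ hinf
  have hne : ∀ n, ((f n : ℂ)) ≠ 1 := by
    intro n h
    have := (f n).2.2
    simp only [h, Set.mem_ofPred_eq, sub_self, norm_zero] at this
    linarith
  choose e he1 he using fun n => exists_eigenvector hW (f n).2.1 (hne n)
  have hfar : ∀ n m, n ≠ m → ε ≤ ‖(W - 1) (e n) - (W - 1) (e m)‖ := by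
    intro n m hnm
    have hort : inner ℂ (e n) (e m) = 0 :=
      inner_eigenvectors hW (spectrum.norm_eq_one_of_unitary hW.1 (f n).2.1)
        (fun h => hnm (f.injective (Subtype.ext h))) (he n) (he m)
    have hx : inner ℂ (e n) ((W - 1) (e n) - (W - 1) (e m)) = (f n : ℂ) - 1 := by
      simp only [sub_apply, one_apply_eq_self, he,
        inner_sub_right, inner_smul_right, hort, inner_self_eq_norm_sq_to_K, he1]
      simp
    calc ε ≤ ‖(f n : ℂ) - 1‖ := (f n).2.2
      _ = ‖inner ℂ (e n) ((W - 1) (e n) - (W - 1) (e m))‖ := by rw [hx]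
      _ ≤ ‖e n‖ * ‖(W - 1) (e n) - (W - 1) (e m)‖ := norm_inner_le_norm _ _
      _ = _ := by rw [he1, one_mul]
  obtain ⟨K, hK, hK'⟩ := IsCompactOperator.image_closedBall_subset_compact
    (f := ((W - 1 : E →L[ℂ] E) : E →ₗ[ℂ] E)) hW.2 1
  obtain ⟨y, -, ψ, hψ, hψy⟩ := hK.tendsto_subseq (fun n => hK' ⟨e n, by simp [he1], rfl⟩)
  have hc := hψy.cauchySeq
  rw [Metric.cauchySeq_iff'] at hc
  obtain ⟨N, hN⟩ := hc ε hε
  have h1 := hN (N + 1) (Nat.le_succ N)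
  rw [dist_eq_norm] at h1
  exact absurd h1 (not_lt.2 (hfar _ _ (hψ.injective.ne (Nat.succ_ne_self N))))

/-- An arc whose closure does not contain `1` has a positive distance from `1`. -/
theorem arc_far {a b : ℝ} (ha : 0 < a) (hb : b < 2 * Real.pi) :
    ∃ ε > 0, arc a b ⊆ {u | ε ≤ ‖u - 1‖} := by
  have hc : IsCompact ((fun θ : ℝ => Complex.exp (θ * I)) '' Set.Icc a b) :=
    isCompact_Icc.image (by fun_prop)
  have h1 : (1 : ℂ) ∉ (fun θ : ℝ => Complex.exp (θ * I)) '' Set.Icc a b := by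
    rintro ⟨θ, hθ, h⟩
    obtain ⟨n, hn⟩ := Complex.exp_eq_one_iff.1 h
    have h2 : (θ : ℂ) = ((n * (2 * Real.pi) : ℝ) : ℂ) := by
      have : (θ : ℂ) * I = (n * (2 * Real.pi)) * I := by rw [hn]; ring
      push_cast
      exact mul_right_cancel₀ I_ne_zero this
    have h3 : θ = n * (2 * Real.pi) := by exact_mod_cast h2
    have hpi := Real.pi_pos
    have h4 : (0 : ℝ) < n := by
      by_contra h
      have : (n : ℝ) * (2 * Real.pi) ≤ 0 :=
        mul_nonpos_of_nonpos_of_nonneg (not_lt.1 h) (by positivity)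
      linarith [hθ.1]
    have h5 : (n : ℝ) < 1 := by
      by_contra h
      have : 1 * (2 * Real.pi) ≤ (n : ℝ) * (2 * Real.pi) :=
        mul_le_mul_of_nonneg_right (not_lt.1 h) (by positivity)
      linarith [hθ.2]
    have h6 : (0 : ℤ) < n := by exact_mod_cast h4
    have h7 : n < (1 : ℤ) := by exact_mod_cast h5
    omega
  obtain ⟨ε, hε, h⟩ := Metric.isOpen_iff.1 hc.isClosed.isOpen_compl 1 h1
  refine ⟨ε, hε, ?_⟩
  rintro u ⟨θ, hθ, rfl⟩
  by_contra hu
  have hm : Complex.exp (θ * I) ∈ Metric.ball (1 : ℂ) ε := by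
    rw [mem_ball_iff_norm]; exact not_le.1 hu
  exact h hm ⟨θ, Set.Ico_subset_Icc_self hθ, rfl⟩

theorem continuousOn_of_zero_near_one {W : E →L[ℂ] E} (hW : W ∈ YInf E) {g : ℂ → ℂ} {ε : ℝ}
    (hε : 0 < ε) (hg : ∀ u, ‖u - 1‖ < ε → g u = 0) : ContinuousOn g (spectrum ℂ W) := by
  intro u hu
  by_cases h : ‖u - 1‖ < ε
  · have hev : ∀ᶠ v in 𝓝 u, g v = 0 := by
      filter_upwards [(isOpen_lt (by fun_prop) continuous_const : IsOpen
        {v : ℂ | ‖v - 1‖ < ε}).mem_nhds h] with v hv using hg v hv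
    exact (ContinuousAt.congr (f := fun _ => (0 : ℂ)) continuousAt_const
      (hev.mono fun v hv => hv.symm)).continuousWithinAt
  · have hfin := finite_spectrum hW (half_pos hε)
    have hcl : IsClosed ((spectrum ℂ W ∩ {u | ε / 2 ≤ ‖u - 1‖}) \ {u}) :=
      (hfin.subset Set.sdiff_subset).isClosed
    have h1 : ((spectrum ℂ W ∩ {u | ε / 2 ≤ ‖u - 1‖}) \ {u})ᶜ ∈ 𝓝 u :=
      hcl.isOpen_compl.mem_nhds (by simp)
    have h2 : {v : ℂ | ε / 2 < ‖v - 1‖} ∈ 𝓝 u :=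
      (isOpen_lt continuous_const (by fun_prop)).mem_nhds (by
        simp only [Set.mem_ofPred_eq]; linarith)
    have hev : ∀ᶠ v in 𝓝[spectrum ℂ W] u, g v = g u := by
      filter_upwards [mem_nhdsWithin_of_mem_nhds h1, mem_nhdsWithin_of_mem_nhds h2,
        self_mem_nhdsWithin] with v hv1 hv2 hv3
      have : v = u := by
        by_contra hne
        exact hv1 ⟨⟨hv3, le_of_lt hv2⟩, hne⟩
      rw [this]
    exact tendsto_const_nhds.congr' (hev.mono fun v hv => hv.symm)

theorem continuousOn_indicator_arc {W : E →L[ℂ] E} (hW : W ∈ YInf E) {a b : ℝ}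
    (ha : 0 < a) (hb : b < 2 * Real.pi) :
    ContinuousOn ((arc a b).indicator (1 : ℂ → ℂ)) (spectrum ℂ W) := by
  obtain ⟨ε, hε, h⟩ := arc_far ha hb
  refine continuousOn_of_zero_near_one hW hε fun u hu => Set.indicator_of_notMem (fun hm => ?_) _
  exact absurd hu (not_lt.2 (h hm))

theorem isStarNormal_of_mem {W : E →L[ℂ] E} (hW : W ∈ YInf E) : IsStarNormal W :=
  ⟨by
    have h := Unitary.mem_iff.1 hW.1
    rw [Commute, SemiconjBy, h.1, h.2]⟩

theorem finiteDimensional_range_specProj {W : E →L[ℂ] E} (hW : W ∈ YInf E) {a b : ℝ}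
    (ha : 0 < a) (hb : b < 2 * Real.pi) :
    FiniteDimensional ℂ (LinearMap.range (specProj W (arc a b) : E →ₗ[ℂ] E)) := by
  obtain ⟨ε, hε, h⟩ := arc_far ha hb
  have := isStarNormal_of_mem hW
  set P := specProj W (arc a b) with hP
  have hc := continuousOn_indicator_arc hW ha hb
  have hidem : P * P = P := by
    rw [hP, specProj, ← cfc_mul _ _ W hc hc]
    congr 1
    ext u
    by_cases hu : u ∈ arc a b <;> simp [hu]
  let g : ℂ → ℂ := fun u => (arc a b).indicator 1 u / (u - 1)
  have hg : ContinuousOn g (spectrum ℂ W) := by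
    refine continuousOn_of_zero_near_one hW hε fun u hu => ?_
    have : u ∉ arc a b := fun hm => absurd hu (not_lt.2 (h hm))
    simp [g, this]
  have hfac : P = (W - 1) * cfc g W := by
    have h1 : W - 1 = cfc (fun u : ℂ => u - 1) W := by
      rw [cfc_sub (fun u : ℂ => u) (fun _ => 1) W, cfc_id' ℂ W, cfc_const_one ℂ W]
    rw [h1, ← cfc_mul _ _ W (by fun_prop) hg, hP, specProj]
    congr 1
    ext u
    by_cases hu : u ∈ arc a b
    · have h2 : u - 1 ≠ 0 := by
        intro h0
        have := h hu
        simp only [Set.mem_ofPred_eq, h0, norm_zero] at this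
        linarith
      simp only [g, hu, Set.indicator_of_mem, Pi.one_apply]
      field_simp
    · simp [g, hu]
  have hcomp : IsCompactOperator (P : E →ₗ[ℂ] E) := by
    rw [hfac]
    exact hW.2.comp_clm (cfc g W)
  have hfix : ∀ x ∈ LinearMap.range (P : E →ₗ[ℂ] E), (P : E →ₗ[ℂ] E) x = x := by
    rintro _ ⟨x, rfl⟩
    exact congrArg (fun Q : E →L[ℂ] E => Q x) hidem
  have hclosed : IsClosed (LinearMap.range (P : E →ₗ[ℂ] E) : Set E) := by
    have : (LinearMap.range (P : E →ₗ[ℂ] E) : Set E) = {x | P x = x} := by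
      ext x
      exact ⟨fun hx => hfix x hx, fun hx => ⟨x, hx⟩⟩
    rw [this]
    exact isClosed_eq P.continuous continuous_id
  have hr := hcomp.restrict (V := LinearMap.range (P : E →ₗ[ℂ] E))
    (fun v _ => ⟨v, rfl⟩) hclosed
  refine FiniteDimensional.of_isCompactOperator_id (𝕜 := ℂ) ?_
  convert! hr using 1
  ext x
  exact (hfix x x.2).symm

theorem arc_union {a b c : ℝ} (hab : a ≤ b) (hbc : b ≤ c) : arc a c = arc a b ∪ arc b c := by
  rw [arc, arc, arc, ← Set.image_union, Set.Ico_union_Ico_eq_Ico hab hbc]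

theorem arc_disjoint {a b c : ℝ} (ha : 0 < a) (hab : a ≤ b) (hbc : b ≤ c)
    (hc : c < 2 * Real.pi) : Disjoint (arc a b) (arc b c) := by
  rw [Set.disjoint_left]
  rintro _ ⟨θ, hθ, rfl⟩ ⟨φ, hφ, h⟩
  have hinj := Circle.exp_injOn_Ico (a := 0) (b := 2 * Real.pi) (by simp)
  have h1 : Circle.exp φ = Circle.exp θ := by
    ext
    simpa [Circle.coe_exp] using h
  have h2 := hinj ⟨by linarith [hφ.1], by linarith [hφ.2]⟩
    ⟨by linarith [hθ.1], by linarith [hθ.2]⟩ h1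
  linarith [hθ.2, hφ.1]

theorem arcRank_add {W : E →L[ℂ] E} (hW : W ∈ YInf E) {a b c : ℝ} (ha : 0 < a) (hab : a ≤ b)
    (hbc : b ≤ c) (hc : c < 2 * Real.pi) :
    arcRank W a c = arcRank W a b + arcRank W b c := by
  have := isStarNormal_of_mem hW
  have h1 := continuousOn_indicator_arc hW ha (lt_of_le_of_lt hbc hc)
  have h2 := continuousOn_indicator_arc hW (lt_of_lt_of_le ha hab) hc
  have hd := arc_disjoint ha hab hbc hc
  have f1 := finiteDimensional_range_specProj hW ha (lt_of_le_of_lt hbc hc)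
  have f2 := finiteDimensional_range_specProj hW (lt_of_lt_of_le ha hab) hc
  have hd' := Set.disjoint_left.1 hd
  have hsum : specProj W (arc a c) = specProj W (arc a b) + specProj W (arc b c) := by
    rw [specProj, specProj, specProj, ← cfc_add _ _ _ h1 h2, arc_union hab hbc,
      Set.indicator_union_of_disjoint hd]
  have hPQ : specProj W (arc a b) * specProj W (arc b c) = 0 := by
    rw [specProj, specProj, ← cfc_mul _ _ W h1 h2, ← cfc_const_zero ℂ W]
    congr 1
    ext u
    by_cases hu : u ∈ arc a b
    · simp [hd' hu]
    · simp [hu]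
  have hQP : specProj W (arc b c) * specProj W (arc a b) = 0 := by
    rw [← hPQ, specProj, specProj]
    exact cfc_commute_cfc _ _ _
  have hPP : specProj W (arc a b) * specProj W (arc a b) = specProj W (arc a b) := by
    rw [specProj, ← cfc_mul _ _ W h1 h1]
    congr 1
    ext u
    by_cases hu : u ∈ arc a b <;> simp [hu]
  have hQQ : specProj W (arc b c) * specProj W (arc b c) = specProj W (arc b c) := by
    rw [specProj, ← cfc_mul _ _ W h2 h2]
    congr 1
    ext u
    by_cases hu : u ∈ arc b c <;> simp [hu]
  rw [arcRank, arcRank, arcRank, hsum]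
  generalize specProj W (arc a b) = P at *
  generalize specProj W (arc b c) = Q at *
  have e1 : ∀ x, P (Q x) = 0 := fun x => congrArg (fun A : E →L[ℂ] E => A x) hPQ
  have e2 : ∀ x, Q (P x) = 0 := fun x => congrArg (fun A : E →L[ℂ] E => A x) hQP
  have e3 : ∀ x, P (P x) = P x := fun x => congrArg (fun A : E →L[ℂ] E => A x) hPP
  have e4 : ∀ x, Q (Q x) = Q x := fun x => congrArg (fun A : E →L[ℂ] E => A x) hQQ
  have hinf : LinearMap.range (P : E →ₗ[ℂ] E) ⊓ LinearMap.range (Q : E →ₗ[ℂ] E) = ⊥ := by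
    rw [eq_bot_iff]
    rintro _ ⟨⟨x, rfl⟩, ⟨y, hy⟩⟩
    simp only [ContinuousLinearMap.coe_coe] at hy ⊢
    rw [Submodule.mem_bot, ← e3 x, ← hy, e1]
  have hsup : LinearMap.range ((P + Q : E →L[ℂ] E) : E →ₗ[ℂ] E) =
      LinearMap.range (P : E →ₗ[ℂ] E) ⊔ LinearMap.range (Q : E →ₗ[ℂ] E) := by
    apply le_antisymm
    · rintro _ ⟨x, rfl⟩
      exact Submodule.add_mem_sup ⟨x, rfl⟩ ⟨x, rfl⟩
    · refine sup_le ?_ ?_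
      · rintro _ ⟨x, rfl⟩
        exact ⟨P x, by simp [e2, e3]⟩
      · rintro _ ⟨x, rfl⟩
        exact ⟨Q x, by simp [e1, e4]⟩
  rw [hsup, ← Submodule.finrank_sup_add_finrank_inf_eq, hinf, finrank_bot, add_zero]

theorem countN_sub {W : E →L[ℂ] E} (hW : W ∈ YInf E) {a b c : ℝ} (ha : a ∈ Set.Ioo 0 (2 * Real.pi))
    (hb : b ∈ Set.Ioo 0 (2 * Real.pi)) (hc : c ∈ Set.Ioo 0 (2 * Real.pi)) :
    countN W a c = countN W a b + countN W b c := by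
  have key : ∀ x y z, 0 < x → x ≤ y → y ≤ z → z < 2 * Real.pi →
      (arcRank W x z : ℤ) = arcRank W x y + arcRank W y z := fun x y z h1 h2 h3 h4 => by
    exact_mod_cast arcRank_add hW h1 h2 h3 h4
  have hz : ∀ x, x ∈ Set.Ioo 0 (2 * Real.pi) → (arcRank W x x : ℤ) = 0 := fun x hx => by
    have := key x x x hx.1 le_rfl le_rfl hx.2
    linarith
  have hN : ∀ x y, x ∈ Set.Ioo 0 (2 * Real.pi) → x ≤ y → countN W x y = arcRank W x y := by
    intro x y hx hxy
    rcases hxy.lt_or_eq with h | rfl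
    · simp [countN, h]
    · simp [countN, hz x hx]
  have hN2 : ∀ x y, x ∈ Set.Ioo 0 (2 * Real.pi) → x ≤ y → countN W y x = -arcRank W x y := by
    intro x y hx hxy
    rcases hxy.lt_or_eq with h | rfl
    · simp [countN, h, not_lt.2 h.le]
    · simp [countN, hz x hx]
  rcases le_total a b with h1 | h1 <;> rcases le_total b c with h2 | h2 <;>
    rcases le_total a c with h3 | h3
  · rw [hN _ _ ha h3, hN _ _ ha h1, hN _ _ hb h2]; exact key _ _ _ ha.1 h1 h2 hc.2
  · have e1 : a = b := by linarith
    have e2 : b = c := by linarith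
    subst e1; subst e2; simp [hN _ _ ha le_rfl, hz _ ha]
  · rw [hN _ _ ha h3, hN _ _ ha h1, hN2 _ _ hc h2]; linarith [key _ _ _ ha.1 h3 h2 hb.2]
  · rw [hN2 _ _ hc h3, hN _ _ ha h1, hN2 _ _ hc h2]; linarith [key _ _ _ hc.1 h3 h1 hb.2]
  · rw [hN _ _ ha h3, hN2 _ _ hb h1, hN _ _ hb h2]; linarith [key _ _ _ hb.1 h1 h3 hc.2]
  · rw [hN2 _ _ hc h3, hN2 _ _ hb h1, hN _ _ hb h2]; linarith [key _ _ _ hb.1 h2 h3 ha.2]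
  · have e1 : a = b := by linarith
    have e2 : b = c := by linarith
    subst e1; subst e2; simp [hN _ _ ha le_rfl, hz _ ha]
  · rw [hN2 _ _ hc h3, hN2 _ _ hb h1, hN2 _ _ hc h2]; linarith [key _ _ _ hc.1 h2 h1 ha.2]

theorem countN_antitone {W : E →L[ℂ] E} (hW : W ∈ YInf E) {c : ℝ}
    (hc : c ∈ Set.Ioo 0 (2 * Real.pi)) :
    Antitone fun θ : Set.Ioo 0 (2 * Real.pi) => countN W θ c := by
  intro a b hab
  have h : (a : ℝ) ≤ b := hab
  have h1 := countN_sub hW a.2 b.2 hc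
  have h2 : 0 ≤ countN W a b := by
    unfold countN
    split_ifs with h3 h4
    · positivity
    · exact absurd h4 (not_lt.2 h)
    · exact le_rfl
  simp only
  linarith

theorem arcRank_eq_zero_near {W : E →L[ℂ] E} (hW : W ∈ YInf E) {b : ℝ}
    (hb : b ∈ Set.Ioo 0 (2 * Real.pi)) : ∃ a ∈ Set.Ioo 0 b, ∀ θ ∈ Set.Ioo a b,
      arcRank W θ b = 0 := by
  obtain ⟨ε, hε, h⟩ := arc_far (half_pos hb.1) hb.2
  have hfin := finite_spectrum hW hε
  have hfin2 : {θ : ℝ | θ ∈ Set.Ico (b / 2) b ∧ Complex.exp (θ * I) ∈ spectrum ℂ W}.Finite := by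
    refine Set.Finite.of_finite_image (f := fun θ : ℝ => Circle.exp θ) ?_ ?_
    · refine Set.Finite.of_finite_image (f := fun u : Circle => (u : ℂ)) (hfin.subset ?_)
        Subtype.val_injective.injOn
      rintro _ ⟨_, ⟨θ, ⟨h1, h2⟩, rfl⟩, rfl⟩
      exact ⟨h2, h ⟨θ, h1, rfl⟩⟩
    · refine (Circle.exp_injOn_Ico (a := 0) (b := 2 * Real.pi) (by simp)).mono ?_
      rintro θ ⟨h1, -⟩
      exact ⟨by linarith [h1.1, hb.1], by linarith [h1.2, hb.2]⟩
  have hnb : {θ : ℝ | θ ∈ Set.Ico (b / 2) b ∧ Complex.exp (θ * I) ∈ spectrum ℂ W}ᶜ ∈ 𝓝 b :=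
    hfin2.isClosed.isOpen_compl.mem_nhds (fun hm => absurd hm.1.2 (lt_irrefl b))
  obtain ⟨δ, hδ, hball⟩ := Metric.mem_nhds_iff.1 hnb
  refine ⟨max (b / 2) (b - δ), ⟨lt_of_lt_of_le (half_pos hb.1) (le_max_left _ _),
    max_lt (by linarith [hb.1]) (by linarith)⟩, fun θ hθ => ?_⟩
  have h0 : specProj W (arc θ b) = 0 := by
    rw [specProj, ← cfc_const_zero ℂ W]
    refine cfc_congr fun u hu => Set.indicator_of_notMem ?_ _
    rintro ⟨φ, hφ, rfl⟩
    have h1 := lt_of_le_of_lt (le_max_left _ _) hθ.1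
    have h2 := lt_of_le_of_lt (le_max_right _ _) hθ.1
    have hφ2 : φ ∈ Metric.ball b δ := by
      rw [mem_ball_iff_norm, Real.norm_eq_abs, abs_lt]
      exact ⟨by linarith [hφ.1], by linarith [hφ.2]⟩
    exact hball hφ2 ⟨⟨by linarith [hφ.1], hφ.2⟩, hu⟩
  rw [arcRank, h0, ContinuousLinearMap.toLinearMap_zero, LinearMap.range_zero, finrank_bot]

theorem countN_leftContinuous {W : E →L[ℂ] E} (hW : W ∈ YInf E) {c : ℝ}
    (hc : c ∈ Set.Ioo 0 (2 * Real.pi)) (b : Set.Ioo 0 (2 * Real.pi)) :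
    ContinuousWithinAt (fun θ : Set.Ioo 0 (2 * Real.pi) => countN W θ c) (Set.Iic b) b := by
  obtain ⟨a, ha, h⟩ := arcRank_eq_zero_near hW b.2
  have hnb : {θ : Set.Ioo 0 (2 * Real.pi) | a < (θ : ℝ)} ∈ 𝓝 b :=
    (isOpen_lt continuous_const continuous_subtype_val).mem_nhds ha.2
  refine tendsto_const_nhds.congr' ?_
  filter_upwards [mem_nhdsWithin_of_mem_nhds hnb, self_mem_nhdsWithin] with θ h1 h2
  rcases (show (θ : ℝ) ≤ b from h2).lt_or_eq with h3 | h3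
  · rw [countN_sub hW θ.2 b.2 hc]
    simp [countN, h3, h θ ⟨h1, h3⟩]
  · rw [h3]

end facts

/-- The set `X̃_∞` of all functions `f : 𝕋 \ {1} → ℤ` such that `θ ↦ f(e^{iθ})` is left continuous
and non-increasing on `(0, 2π)`.  Here `𝕋 \ {1}` is parametrized by `θ ∈ (0, 2π)`. -/
def XtInf : Set (Set.Ioo (0 : ℝ) (2 * Real.pi) → ℤ) :=
  {f | Antitone f ∧ ∀ θ, ContinuousWithinAt f (Set.Iic θ) θ}

/-- Two functions of `X̃_∞` are equivalent if they differ by an integer constant. -/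
def XtInf.setoid : Setoid XtInf where
  r f g := ∃ n : ℤ, ∀ θ, f.1 θ = g.1 θ + n
  iseqv :=
    { refl := fun _ => ⟨0, fun _ => by simp⟩
      symm := fun ⟨n, h⟩ => ⟨-n, fun θ => by simp [h θ]⟩
      trans := fun ⟨n, h⟩ ⟨m, k⟩ => ⟨m + n, fun θ => by rw [h θ, k θ, add_assoc]⟩ }

/-- The space `X_∞` of functions of `X̃_∞` modulo integer constants. -/
def XInf : Type := Quotient XtInf.setoid

/-- The function `z ↦ N(z, e^{iθ₀}; W)` as an element of `X̃_∞`. -/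
def countFun {E : Type*} [NormedAddCommGroup E] [InnerProductSpace ℂ E] [CompleteSpace E]
    (W : YInf E) (θ₀ : Set.Ioo (0 : ℝ) (2 * Real.pi)) : XtInf :=
  ⟨fun θ => countN W.1 θ θ₀, countN_antitone W.2 θ₀.2, countN_leftContinuous W.2 θ₀.2⟩

/-- The mapping `η_∞ : Y_∞ → X_∞`, `η_∞(W)` is the class of `N(·, z₀; W)`.  The reference point is
irrelevant (see `etaInf_eq`) and is taken to be `z₀ = -1`. -/
def etaInf {E : Type*} [NormedAddCommGroup E] [InnerProductSpace ℂ E] [CompleteSpace E]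
    (W : YInf E) : XInf :=
  Quotient.mk XtInf.setoid
    (countFun W ⟨Real.pi, Real.pi_pos, by linarith [Real.pi_pos]⟩)

theorem etaInf_eq {E : Type*} [NormedAddCommGroup E] [InnerProductSpace ℂ E] [CompleteSpace E]
    (W : YInf E) (θ₀ : Set.Ioo (0 : ℝ) (2 * Real.pi)) :
    etaInf W = Quotient.mk XtInf.setoid (countFun W θ₀) :=
  Quotient.sound (s := XtInf.setoid) ⟨countN W.1 θ₀ Real.pi, fun θ =>
    countN_sub W.2 θ.2 θ₀.2 ⟨Real.pi_pos, by linarith [Real.pi_pos]⟩⟩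

/-! ### Resolvents and functions of an unbounded self-adjoint operator -/

section operators

variable {H K : Type*} [NormedAddCommGroup H] [InnerProductSpace ℂ H] [CompleteSpace H]
  [NormedAddCommGroup K] [InnerProductSpace ℂ K] [CompleteSpace K]

/-- `R` is a bounded two-sided inverse of `A - z : Dom A → H`. -/
def IsResolventAt (A : H →ₗ.[ℂ] H) (z : ℂ) (R : H →L[ℂ] H) : Prop :=
  (∀ x : H, ∃ hx : R x ∈ A.domain, A ⟨R x, hx⟩ - z • R x = x) ∧
    ∀ x : A.domain, R (A x - z • (x : H)) = x

open Classical in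
/-- The resolvent `(A - z)⁻¹` (equal to `0` by convention if `z` is not in the resolvent set). -/
def res (A : H →ₗ.[ℂ] H) (z : ℂ) : H →L[ℂ] H :=
  if h : ∃ R, IsResolventAt A z R then h.choose else 0

/-- The Cayley transform `(A - i)(A + i)⁻¹ = I - 2i (A + i)⁻¹`. -/
def cayley (A : H →ₗ.[ℂ] H) : H →L[ℂ] H := 1 - (2 * I) • res A (-I)

/-- `φ(A)` for a self-adjoint operator `A` and a continuous function `φ` with compact support, by
means of the continuous functional calculus of the Cayley transform: `u = (x - i) / (x + i)`
corresponds to `x = i (1 + u) / (1 - u)`, and `φ` is extended by `0` to the point `u = 1`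
(that is, `x = ∞`). -/
def funcCc (A : H →ₗ.[ℂ] H) (φ : ℝ → ℂ) : H →L[ℂ] H :=
  cfc (fun u : ℂ => if u = 1 then 0 else φ (I * (1 + u) / (1 - u)).re) (cayley A)

/-- The graph of `f(A)` for a self-adjoint operator `A` and a continuous function `f`, possibly
unbounded: `y = f(A) x` if and only if `φ(A) y = (φ f)(A) x` for all continuous `φ` with compact
support. (In terms of the spectral measure `E` of `A` this says that
`∫ φ dE y = ∫ φ f dE x` for all `φ`, which holds for some `y` if and only if
`∫ |f|² d(E x, x) < ∞`, and then `y = ∫ f dE x`.) -/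
def funcGraph (A : H →ₗ.[ℂ] H) (f : ℝ → ℂ) : Submodule ℂ (H × H) where
  carrier := {p | ∀ φ : ℝ → ℂ, Continuous φ → HasCompactSupport φ →
    funcCc A φ p.2 = funcCc A (fun x => φ x * f x) p.1}
  add_mem' := fun hp hq φ h1 h2 => by
    simp only [Prod.fst_add, Prod.snd_add, map_add, hp φ h1 h2, hq φ h1 h2]
  zero_mem' := fun φ _ _ => by simp
  smul_mem' := fun c p hp φ h1 h2 => by
    simp only [Prod.smul_fst, Prod.smul_snd, map_smul, hp φ h1 h2]

/-- The operator `f(A)` with its natural domain, for a self-adjoint operator `A` and a continuous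
function `f`. -/
def func (A : H →ₗ.[ℂ] H) (f : ℝ → ℂ) : H →ₗ.[ℂ] H := (funcGraph A f).toLinearPMap

/-- The bounded operator `C` is equal to the product `T B`; in particular `Ran B ⊆ Dom T`. -/
def IsProd {E F D : Type*} [NormedAddCommGroup E] [InnerProductSpace ℂ E]
    [NormedAddCommGroup F] [InnerProductSpace ℂ F] [NormedAddCommGroup D] [InnerProductSpace ℂ D]
    (T : E →ₗ.[ℂ] F) (B : D →L[ℂ] E) (C : D →L[ℂ] F) : Prop :=
  ∀ x : D, ∃ hx : B x ∈ T.domain, T ⟨B x, hx⟩ = C x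

open Classical in
/-- The product `T B` of an unbounded operator `T` and a bounded operator `B`, as a bounded
operator (equal to `0` by convention if it is not everywhere defined and bounded). -/
def prodCLM {E F D : Type*} [NormedAddCommGroup E] [InnerProductSpace ℂ E]
    [NormedAddCommGroup F] [InnerProductSpace ℂ F] [NormedAddCommGroup D] [InnerProductSpace ℂ D]
    (T : E →ₗ.[ℂ] F) (B : D →L[ℂ] E) : D →L[ℂ] F :=
  if h : ∃ C, IsProd T B C then h.choose else 0

/-- `f(A)` as a bounded operator, for a self-adjoint operator `A` and a bounded continuous
function `f`. -/
def funcB (A : H →ₗ.[ℂ] H) (f : ℝ → ℂ) : H →L[ℂ] H := prodCLM (func A f) 1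

/-! ### The operators `T(z)`, `B(z)`, `H(H₀, G, J)`, `M(z)`, `S(z)` -/

/-- `(|A| + I)^{1/2}` with its natural domain. -/
def sqrtAbsAddOne (A : H →ₗ.[ℂ] H) : H →ₗ.[ℂ] H := func A fun x => (Real.sqrt (|x| + 1) : ℂ)

/-- The bounded operator `(|A| + I)^{-1/2}`. -/
def invSqrtAbsAddOne (A : H →ₗ.[ℂ] H) : H →L[ℂ] H :=
  funcB A fun x => ((Real.sqrt (|x| + 1))⁻¹ : ℂ)

/-- The assumptions on `H₀`, `G`, `J`: `H₀` is self-adjoint,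
`Dom (|H₀| + I)^{1/2} ⊆ Dom G`, `G (|H₀| + I)^{-1/2}` is compact, `J` is bounded and self-adjoint
and `0 ∈ ρ(J)`. -/
structure Assumptions (H₀ : H →ₗ.[ℂ] H) (G : H →ₗ.[ℂ] K) (J : K →L[ℂ] K) : Prop where
  selfAdjoint : IsSelfAdjoint H₀
  domain_le : (sqrtAbsAddOne H₀).domain ≤ G.domain
  compact : ∃ C : H →L[ℂ] K, IsProd G (invSqrtAbsAddOne H₀) C ∧ IsCompactOperator C
  selfAdjoint_J : IsSelfAdjoint J
  zero_mem_J : (0 : ℂ) ∈ resolventSet ℂ J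

/-- `T(z; H₀, G) = (G (|H₀| + I)^{-1/2}) ((|H₀| + I) / (H₀ - z)) (G (|H₀| + I)^{-1/2})*`. -/
def opT (H₀ : H →ₗ.[ℂ] H) (G : H →ₗ.[ℂ] K) (z : ℂ) : K →L[ℂ] K :=
  prodCLM G (invSqrtAbsAddOne H₀) ∘L funcB H₀ (fun x => (|x| + 1 : ℂ) / (x - z)) ∘L
    ContinuousLinearMap.adjoint (prodCLM G (invSqrtAbsAddOne H₀))

/-- `B(z; H₀, G) = Im T(z) = (T(z) - T(z)*) / 2i`. -/
def opB (H₀ : H →ₗ.[ℂ] H) (G : H →ₗ.[ℂ] K) (z : ℂ) : K →L[ℂ] K :=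
  (imaginaryPart (opT H₀ G z) : K →L[ℂ] K)

/-- The square root `B^{1/2}` of a self-adjoint operator, with the branch `x^{1/2} = i |x|^{1/2}` of
the square root for `x < 0`.  (For `Im z > 0` one has `B(z) ≥ 0`, for `Im z < 0` one has
`B(z) ≤ 0`.) -/
def opSqrt (B : K →L[ℂ] K) : K →L[ℂ] K := cfc (fun w : ℂ => w ^ (1 / 2 : ℂ)) B

/-- `H` is a self-adjoint operator whose resolvent satisfies
`(H - z)⁻¹ - (H₀ - z)⁻¹ = -(G (H₀ - z̄)⁻¹)* (I + J T(z))⁻¹ (J G (H₀ - z)⁻¹)` for all non-real `z`.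
There is exactly one such operator if `H₀`, `G`, `J` satisfy `Assumptions`. -/
def IsPerturbed (H₀ : H →ₗ.[ℂ] H) (G : H →ₗ.[ℂ] K) (J : K →L[ℂ] K) (H₁ : H →ₗ.[ℂ] H) : Prop :=
  IsSelfAdjoint H₁ ∧ ∀ z : ℂ, z.im ≠ 0 →
    res H₁ z - res H₀ z =
      -(ContinuousLinearMap.adjoint (prodCLM G (res H₀ (starRingEnd ℂ z))) ∘L
        Ring.inverse (1 + J ∘L opT H₀ G z) ∘L (J ∘L prodCLM G (res H₀ z)))

open Classical in
/-- The operator `H = H(H₀, G, J)`, which corresponds to the formal sum `H₀ + G* J G`. -/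
def perturbed (H₀ : H →ₗ.[ℂ] H) (G : H →ₗ.[ℂ] K) (J : K →L[ℂ] K) : H →ₗ.[ℂ] H :=
  if h : ∃ H₁, IsPerturbed H₀ G J H₁ then h.choose else H₀

/-- `M(z; H, H₀) = (I + (z - z̄) (H - z)⁻¹) (I + (z̄ - z) (H₀ - z̄)⁻¹)`. -/
def opM (H₁ H₀ : H →ₗ.[ℂ] H) (z : ℂ) : H →L[ℂ] H :=
  (1 + (z - starRingEnd ℂ z) • res H₁ z) ∘L
    (1 + (starRingEnd ℂ z - z) • res H₀ (starRingEnd ℂ z))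

/-- `S(z; H₀, G, J) = I - 2i B^{1/2}(z) (J⁻¹ + T(z))⁻¹ B^{1/2}(z)`. -/
def opS (H₀ : H →ₗ.[ℂ] H) (G : H →ₗ.[ℂ] K) (J : K →L[ℂ] K) (z : ℂ) : K →L[ℂ] K :=
  1 - (2 * I) • (opSqrt (opB H₀ G z) ∘L Ring.inverse (Ring.inverse J + opT H₀ G z) ∘L
    opSqrt (opB H₀ G z))

end operators

end SpecFlow

end

noncomputable section

namespace SpecFlow

open Complex Topology

/-! ### Resolvents of self-adjoint operators -/

section resolvents

variable {H : Type*} [NormedAddCommGroup H] [InnerProductSpace ℂ H]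

/-! Write `R₀(z) = (H₀ - z)⁻¹`, `X = (J⁻¹ + T(z))⁻¹`, `Γ = (G R₀(z̄))*` and `Q = B^{1/2}(z)`. The
resolvent formula for `H` turns the product defining `M` into `M - I = ΓΛ` with `Λ = (z̄ - z) X G
R₀(z̄)` (`Assumptions.opM_eq`), while by definition `S - I = QV` with `V = -2i XQ`. Since `Im T(z) =
Im z · G R₀(z̄) (G R₀(z̄))*` (`opB_eq`), both reversed products agree: `ΛΓ = -2i X B(z) = VQ`. As
`ΓΛ` and `ΛΓ` have isomorphic eigenspaces for every nonzero eigenvalue, and likewise `QV` and `VQ`,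
the operators `M` and `S` have the same eigenvalues different from `1` with the same multiplicities
(`Assumptions.finrank_eigenspace_opM`).

It remains to see that these multiplicities determine `η_∞`. For `W` in `Y_∞` the spectrum in an arc
away from `1` is finite and consists of eigenvalues, so the rank of the spectral projection of the
arc is the sum of the dimensions of the eigenspaces (`arcRank_eq_sum`). `M` is a product of two
unitary operators of the form `(A - z̄)(A - z)⁻¹`; `S` is unitary because `Q² = Im (J⁻¹ + T(z))` and
`Q* = ± Q` (`one_sub_mem_unitary`). Compactness comes from that of `G (|H₀| + I)^{-1/2}`.

The operators are defined by choice, so each has to be identified. The functions of `H₀` in `T(z)`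
are defined by testing against compactly supported functions, and are matched with a bounded
calculus built on the Cayley transform (`funcB_eq_bddFunc`). The operator `H` exists because `I + J
T(z)` is invertible (`Assumptions.isUnit_one_add`) and the right-hand side of the resolvent formula
is an injective pseudo-resolvent with `R(z)* = R(z̄)`, hence the resolvent of a self-adjoint
operator (`exists_isSelfAdjoint_of_pseudoResolvent`). -/

theorem IsResolventAt.sub_eq {A : H →ₗ.[ℂ] H} {z w : ℂ} {R R' : H →L[ℂ] H}
    (h : IsResolventAt A z R) (h' : IsResolventAt A w R') : R - R' = (z - w) • (R * R') := by
  ext x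
  obtain ⟨hx, e⟩ := h'.1 x
  have h1 : R (A ⟨R' x, hx⟩ - z • R' x) = R' x := h.2 ⟨R' x, hx⟩
  have h2 : A ⟨R' x, hx⟩ - z • R' x = x + (w - z) • R' x := by
    rw [sub_eq_iff_eq_add.1 e]
    module
  rw [h2, map_add, map_smul] at h1
  simp only [sub_apply, smul_apply, mul_apply_eq_comp]
  linear_combination (norm := module) h1

theorem IsResolventAt.eq_zero {A : H →ₗ.[ℂ] H} {z : ℂ} {R : H →L[ℂ] H}
    (h : IsResolventAt A z R) {x : H} (hx : R x = 0) : x = 0 := by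
  obtain ⟨h1, h2⟩ := h.1 x
  have h3 : (⟨R x, h1⟩ : A.domain) = 0 := Subtype.ext hx
  rw [h3, hx, A.map_zero, smul_zero, sub_zero] at h2
  exact h2.symm

theorem IsResolventAt.unique {A : H →ₗ.[ℂ] H} {z : ℂ} {R R' : H →L[ℂ] H}
    (h : IsResolventAt A z R) (h' : IsResolventAt A z R') : R = R' := by
  have := h.sub_eq h'
  rwa [sub_self, zero_smul, sub_eq_zero] at this

theorem IsResolventAt.res_eq {A : H →ₗ.[ℂ] H} {z : ℂ} {R : H →L[ℂ] H}
    (h : IsResolventAt A z R) : res A z = R := by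
  have hex : ∃ R, IsResolventAt A z R := ⟨R, h⟩
  rw [res, dif_pos hex]
  exact hex.choose_spec.unique h

variable [CompleteSpace H]

theorem _root_.IsSelfAdjoint.inner_linearPMap {A : H →ₗ.[ℂ] H} (hA : IsSelfAdjoint A)
    (x y : A.domain) : inner ℂ (A x) (y : H) = inner ℂ (x : H) (A y) := by
  have h := A.adjoint_isFormalAdjoint hA.dense_domain
  rw [LinearPMap.isSelfAdjoint_def.1 hA] at h
  exact h x y

theorem _root_.IsSelfAdjoint.mem_domain_of_inner {A : H →ₗ.[ℂ] H} (hA : IsSelfAdjoint A)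
    {y w : H} (h : ∀ x : A.domain, inner ℂ w (x : H) = inner ℂ y (A x)) :
    ∃ hy : y ∈ A.domain, A ⟨y, hy⟩ = w := by
  -- A free `B` in place of `A` lets the equation `A* = A` be eliminated without rewriting inside
  -- the dependent pair `⟨y, hy⟩`.
  have key : ∀ B : H →ₗ.[ℂ] H, A.adjoint = B → ∃ hy : y ∈ B.domain, B ⟨y, hy⟩ = w := by
    rintro _ rfl
    have hm := A.mem_adjoint_domain_of_exists y ⟨w, h⟩
    exact ⟨hm, A.adjoint_apply_eq hA.dense_domain ⟨y, hm⟩ h⟩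
  exact key A (LinearPMap.isSelfAdjoint_def.1 hA)

/-- `(x, Ax)` is real, so `(x, (A - z)x)` has imaginary part `-Im z ‖x‖²`; Cauchy–Schwarz gives the
rest. -/
theorem _root_.IsSelfAdjoint.abs_im_mul_norm_le {A : H →ₗ.[ℂ] H} (hA : IsSelfAdjoint A) (z : ℂ)
    (x : A.domain) : |z.im| * ‖(x : H)‖ ≤ ‖A x - z • (x : H)‖ := by
  have h1 : (inner ℂ (x : H) (A x)).im = 0 := by
    rw [← Complex.conj_eq_iff_im, inner_conj_symm, hA.inner_linearPMap]
  have h2 : (inner ℂ (x : H) (A x - z • (x : H))).im = -(z.im * ‖(x : H)‖ ^ 2) := by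
    rw [inner_sub_right, inner_smul_right, inner_self_eq_norm_sq_to_K, Complex.sub_im, h1,
      zero_sub, ← Complex.im_mul_ofReal]
    norm_cast
  have h3 : |z.im| * ‖(x : H)‖ ^ 2 ≤ ‖(x : H)‖ * ‖A x - z • (x : H)‖ := by
    calc |z.im| * ‖(x : H)‖ ^ 2 = |(inner ℂ (x : H) (A x - z • (x : H))).im| := by
          rw [h2, abs_neg, abs_mul, abs_of_nonneg (sq_nonneg ‖(x : H)‖)]
      _ ≤ ‖inner ℂ (x : H) (A x - z • (x : H))‖ := Complex.abs_im_le_norm _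
      _ ≤ _ := norm_inner_le_norm _ _
  rcases (norm_nonneg (x : H)).eq_or_lt with h | h
  · rw [← h, mul_zero]; exact norm_nonneg _
  · nlinarith

/-- On the graph of `A`, complete because `A` is closed, `A - z` becomes a bounded operator which is
bounded below. Its range is therefore closed, and the orthogonal complement of the range is `ker (A
- z̄) = 0`, so it is a bijection with continuous inverse. -/
theorem _root_.IsSelfAdjoint.exists_isResolventAt {A : H →ₗ.[ℂ] H} (hA : IsSelfAdjoint A) {z : ℂ}
    (hz : z.im ≠ 0) : ∃ R, IsResolventAt A z R := by
  have hcl : IsClosed (A.graph : Set (H × H)) := hA.isClosed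
  have : CompleteSpace A.graph := hcl.completeSpace_coe
  have hpos : 0 < |z.im| := abs_pos.2 hz
  let T : A.graph →L[ℂ] H :=
    (ContinuousLinearMap.snd ℂ H H - z • ContinuousLinearMap.fst ℂ H H) ∘L A.graph.subtypeL
  have hT : ∀ p : A.graph, T p = p.1.2 - z • p.1.1 := fun p => rfl
  have hb1 : ∀ p : A.graph, ‖p.1.1‖ ≤ |z.im|⁻¹ * ‖T p‖ := by
    intro p
    obtain ⟨y, hy1, hy2⟩ := LinearPMap.mem_graph_iff _ |>.1 p.2
    rw [hT, ← hy1, ← hy2, inv_mul_eq_div, le_div_iff₀ hpos, mul_comm]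
    exact hA.abs_im_mul_norm_le z y
  have hb2 : ∀ p : A.graph, ‖p.1.2‖ ≤ (1 + ‖z‖ * |z.im|⁻¹) * ‖T p‖ := by
    intro p
    calc ‖p.1.2‖ = ‖T p + z • p.1.1‖ := by rw [hT, sub_add_cancel]
      _ ≤ ‖T p‖ + ‖z‖ * ‖p.1.1‖ := (norm_add_le _ _).trans (by rw [norm_smul])
      _ ≤ ‖T p‖ + ‖z‖ * (|z.im|⁻¹ * ‖T p‖) := by gcongr; exact hb1 p
      _ = _ := by ring
  have hanti : AntilipschitzWith (max |z.im|⁻¹ (1 + ‖z‖ * |z.im|⁻¹)).toNNReal T := by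
    refine ContinuousLinearMap.antilipschitz_of_bound _ fun p => ?_
    rw [Real.coe_toNNReal _ (le_max_of_le_left (by positivity)), Submodule.coe_norm, Prod.norm_def]
    refine max_le ((hb1 p).trans ?_) ((hb2 p).trans ?_) <;> gcongr
    · exact le_max_left _ _
    · exact le_max_right _ _
  have hrange : T.range = ⊤ := by
    have hclosed : IsClosed (T.range : Set H) := by
      rw [LinearMap.coe_range]
      exact hanti.isClosed_range T.uniformContinuous
    have : CompleteSpace T.range := hclosed.completeSpace_coe
    rw [← Submodule.orthogonal_eq_bot_iff, eq_bot_iff]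
    intro w hw
    rw [Submodule.mem_orthogonal'] at hw
    have h1 : ∀ x : A.domain, inner ℂ (starRingEnd ℂ z • w) (x : H) = inner ℂ w (A x) := by
      intro x
      have h2 := hw (T ⟨((x : H), A x), A.mem_graph x⟩) ⟨_, rfl⟩
      rw [hT, inner_sub_right, inner_smul_right, sub_eq_zero] at h2
      rw [inner_smul_left, Complex.conj_conj, ← h2]
    obtain ⟨hwd, h2⟩ := hA.mem_domain_of_inner h1
    have h3 := hA.abs_im_mul_norm_le (starRingEnd ℂ z) ⟨w, hwd⟩
    rw [h2, sub_self, norm_zero, Complex.conj_im, abs_neg] at h3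
    have h4 : ‖w‖ = 0 := le_antisymm (by
      by_contra h
      exact absurd h3 (not_le.2 (mul_pos hpos (not_le.1 h)))) (norm_nonneg _)
    exact norm_eq_zero.1 h4
  let e := ContinuousLinearEquiv.ofBijective T (LinearMap.ker_eq_bot.2 hanti.injective) hrange
  have he : ∀ p, e p = T p := fun p => rfl
  refine ⟨ContinuousLinearMap.fst ℂ H H ∘L A.graph.subtypeL ∘L
    (e.symm : H →L[ℂ] A.graph), fun x => ?_, fun x => ?_⟩
  · obtain ⟨y, hy1, hy2⟩ := LinearPMap.mem_graph_iff _ |>.1 (e.symm x).2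
    have hx : T (e.symm x) = x := by rw [← he, e.apply_symm_apply]
    have hR : (ContinuousLinearMap.fst ℂ H H ∘L A.graph.subtypeL ∘L
      (e.symm : H →L[ℂ] A.graph)) x = y := hy1.symm
    refine ⟨hR ▸ y.2, ?_⟩
    have h2 : ∀ (v : H) (hv : v ∈ A.domain), v = y → A ⟨v, hv⟩ - z • v = x := by
      rintro _ _ rfl
      rw [← hx, hT, ← hy1, ← hy2]
    exact h2 _ _ hR
  · have : A x - z • (x : H) = e ⟨((x : H), A x), A.mem_graph x⟩ := by rw [he, hT]
    simp [this]

theorem _root_.IsSelfAdjoint.isResolventAt_res {A : H →ₗ.[ℂ] H} (hA : IsSelfAdjoint A) {z : ℂ}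
    (hz : z.im ≠ 0) : IsResolventAt A z (res A z) := by
  obtain ⟨R, hR⟩ := hA.exists_isResolventAt hz
  rwa [hR.res_eq]

theorem conj_im_ne_zero {z : ℂ} (hz : z.im ≠ 0) : (starRingEnd ℂ z).im ≠ 0 := by
  rwa [Complex.conj_im, neg_ne_zero]

theorem star_res {A : H →ₗ.[ℂ] H} (hA : IsSelfAdjoint A) {z : ℂ} (hz : z.im ≠ 0) :
    star (res A z) = res A (starRingEnd ℂ z) := by
  rw [ContinuousLinearMap.star_eq_adjoint]
  refine ((ContinuousLinearMap.eq_adjoint_iff _ _).2 fun x y => ?_).symm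
  obtain ⟨hy, e1⟩ := (hA.isResolventAt_res hz).1 y
  obtain ⟨hx, e2⟩ := (hA.isResolventAt_res (conj_im_ne_zero hz)).1 x
  have h := hA.inner_linearPMap ⟨_, hx⟩ ⟨_, hy⟩
  simp only at h
  have h1 := congrArg (fun v => inner ℂ (res A (starRingEnd ℂ z) x) v) e1
  have h2 := congrArg (fun v => inner ℂ v (res A z y)) e2
  simp only [inner_sub_left, inner_sub_right, inner_smul_left, inner_smul_right,
    Complex.conj_conj] at h1 h2
  rw [← h1, ← h2, h]

theorem one_add_smul_mul_eq_one {B : Type*} [Ring B] [Algebra ℂ B] {R R' : B} {z w : ℂ}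
    (h : R - R' = (z - w) • (R * R')) : (1 + (z - w) • R) * (1 + (w - z) • R') = 1 := by
  have h1 : (1 + (z - w) • R) * (1 + (w - z) • R') =
      1 + (z - w) • (R - R' - (z - w) • (R * R')) := by
    simp only [mul_add, add_mul, one_mul, mul_one, smul_mul_assoc, mul_smul_comm]
    module
  rw [h1, h, sub_self, smul_zero, add_zero]

/-- `(A - w)(A - z)⁻¹ = I + (z - w) (A - z)⁻¹`, with inverse `I + (w - z) (A - w)⁻¹`. -/
theorem one_add_res_mul {A : H →ₗ.[ℂ] H} (hA : IsSelfAdjoint A) {z w : ℂ} (hz : z.im ≠ 0)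
    (hw : w.im ≠ 0) : (1 + (z - w) • res A z) * (1 + (w - z) • res A w) = 1 :=
  one_add_smul_mul_eq_one ((hA.isResolventAt_res hz).sub_eq (hA.isResolventAt_res hw))

/-- This is `(A - z̄)(A - z)⁻¹`; taking the adjoint exchanges `z` and `z̄`, which gives the inverse.
The Cayley transform and both factors of `M` have this form. -/
theorem one_add_res_mem_unitary {A : H →ₗ.[ℂ] H} (hA : IsSelfAdjoint A) {z : ℂ}
    (hz : z.im ≠ 0) : 1 + (z - starRingEnd ℂ z) • res A z ∈ unitary (H →L[ℂ] H) := by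
  have hs : star (1 + (z - starRingEnd ℂ z) • res A z) =
      1 + (starRingEnd ℂ z - z) • res A (starRingEnd ℂ z) := by
    rw [star_add, star_one, star_smul, star_res hA hz, star_sub]
    simp
  rw [Unitary.mem_iff, hs]
  exact ⟨one_add_res_mul hA (conj_im_ne_zero hz) hz, one_add_res_mul hA hz (conj_im_ne_zero hz)⟩

/-- A pseudo-resolvent with `R(z)* = R(z̄)` which is injective is the resolvent of a self-adjoint
operator. -/
theorem exists_isSelfAdjoint_of_pseudoResolvent (R : ℂ → H →L[ℂ] H)
    (hadj : ∀ z, z.im ≠ 0 → star (R z) = R (starRingEnd ℂ z))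
    (hres : ∀ z w, z.im ≠ 0 → w.im ≠ 0 → R z - R w = (z - w) • (R z * R w))
    (hinj : ∀ z, z.im ≠ 0 → ∀ x, R z x = 0 → x = 0) :
    ∃ A : H →ₗ.[ℂ] H, IsSelfAdjoint A ∧ ∀ z, z.im ≠ 0 → IsResolventAt A z (R z) := by
  have hi : (I : ℂ).im ≠ 0 := by simp
  have hinjI : Function.Injective (R I) := (injective_iff_map_eq_zero _).2 (hinj I hi)
  let e : H ≃ₗ[ℂ] (R I).range := LinearEquiv.ofInjective (R I : H →ₗ[ℂ] H) hinjI
  -- The only candidate is `A = R(i)⁻¹ + i` on the range of `R(i)`; the resolvent identity carries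
  -- it from `i` to every `z`.
  let A : H →ₗ.[ℂ] H := ⟨(R I).range, (e.symm : (R I).range →ₗ[ℂ] H) + I • (R I).range.subtype⟩
  have hA : ∀ (x v : H) (hv : v ∈ A.domain), v = R I x → A ⟨v, hv⟩ = x + I • v := by
    rintro x _ hv rfl
    change e.symm ⟨R I x, hv⟩ + I • R I x = _
    have : (⟨R I x, hv⟩ : (R I).range) = e x := rfl
    rw [this, e.symm_apply_apply]
  have hdom : ∀ x : A.domain, ∃ y, (x : H) = R I y ∧ A x = y + I • R I y := by
    rintro ⟨_, y, rfl⟩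
    exact ⟨y, rfl, hA y _ _ rfl⟩
  have hR : ∀ z, z.im ≠ 0 → IsResolventAt A z (R z) := by
    intro z hz
    have h1 : R z = R I * (1 + (z - I) • R z) := by
      have := hres I z hi hz
      rw [mul_add, mul_one, mul_smul_comm]
      linear_combination (norm := module) -this
    have h2 : R z = (1 + (z - I) • R z) * R I := by
      have := hres z I hz hi
      rw [add_mul, one_mul, smul_mul_assoc, ← this, add_sub_cancel]
    refine ⟨fun x => ?_, fun x => ?_⟩
    · have hx : R z x = R I ((1 + (z - I) • R z) x) := congrArg (fun T : H →L[ℂ] H => T x) h1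
      have hm : R z x ∈ A.domain := ⟨_, hx.symm⟩
      refine ⟨hm, ?_⟩
      rw [hA _ _ hm hx]
      simp only [add_apply, one_apply_eq_self, smul_apply]
      module
    · obtain ⟨y, hy1, hy2⟩ := hdom x
      have hx : R z y = ((1 + (z - I) • R z) * R I) y := congrArg (fun T : H →L[ℂ] H => T y) h2
      simp only [add_apply, one_apply_eq_self, smul_apply, mul_apply_eq_comp] at hx
      rw [hy2, hy1, map_sub, map_add, map_smul, map_smul, hx]
      module
  have hdense : Dense (A.domain : Set H) := by
    rw [Submodule.dense_iff_topologicalClosure_eq_top, Submodule.topologicalClosure_eq_top_iff]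
    change ((R I).range)ᗮ = ⊥
    rw [ContinuousLinearMap.orthogonal_range, ← ContinuousLinearMap.star_eq_adjoint, hadj I hi]
    exact LinearMap.ker_eq_bot'.2 (hinj _ (conj_im_ne_zero hi))
  have hsymm : A.IsFormalAdjoint A := by
    intro x y
    obtain ⟨u, hu, hAu⟩ := hdom x
    obtain ⟨v, hv, hAv⟩ := hdom y
    have h1 := hadj I hi
    have h2 := hres I (starRingEnd ℂ I) hi (conj_im_ne_zero hi)
    have h3 : ∀ a b, inner ℂ (R I a) b = inner ℂ a (R (starRingEnd ℂ I) b) := fun a b => by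
      rw [← h1, ContinuousLinearMap.star_eq_adjoint, ContinuousLinearMap.adjoint_inner_right]
    have h4 := hres (starRingEnd ℂ I) I (conj_im_ne_zero hi) hi
    have h5 : R I v = R (starRingEnd ℂ I) v + (2 * I) • R (starRingEnd ℂ I) (R I v) := by
      have := congrArg (fun T : H →L[ℂ] H => T v) h4
      simp only [sub_apply, smul_apply, mul_apply_eq_comp, Complex.conj_I] at this
      rw [sub_eq_iff_eq_add] at this
      rw [Complex.conj_I, this]
      module
    rw [hAu, hAv, hu, hv, inner_add_left, inner_add_right, inner_smul_left, inner_smul_right,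
      h3 u v, h3 u (R I v)]
    nth_rewrite 1 [h5]
    rw [inner_add_right, inner_smul_right, Complex.conj_I]
    ring
  refine ⟨A, ?_, hR⟩
  rw [LinearPMap.isSelfAdjoint_def]
  refine le_antisymm ?_ (hsymm.le_adjoint hdense)
  refine LinearPMap.le_of_le_graph fun p hp => ?_
  obtain ⟨y, hy1, hy2⟩ := (LinearPMap.mem_graph_iff _).1 hp
  obtain ⟨hm, hw⟩ := (hR I hi).1 (p.2 - I • p.1)
  set w : A.domain := ⟨R I (p.2 - I • p.1), hm⟩ with hwdef
  have hAw : A w - I • (w : H) = p.2 - I • p.1 := hw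
  -- For `p` in the graph of `A*` and `w = R(i)(A* - i)p`, the vector `p.1 - w` is orthogonal to the
  -- range of `A + i`. That range is the whole space, so `p.1 - w` can be tested against itself.
  have hzero : p.1 - w = 0 := by
    have hc : (starRingEnd ℂ I).im ≠ 0 := conj_im_ne_zero hi
    obtain ⟨hm', hw'⟩ := (hR (starRingEnd ℂ I) hc).1 (p.1 - w)
    set d : A.domain := ⟨R (starRingEnd ℂ I) (p.1 - w), hm'⟩
    have e1 : inner ℂ p.2 (d : H) = inner ℂ p.1 (A d) := by
      rw [← hy1, ← hy2]
      exact A.adjoint_isFormalAdjoint hdense y d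
    have e2 : inner ℂ (A w) (d : H) = inner ℂ (w : H) (A d) := hsymm w d
    have e3 : inner ℂ (A w) (d : H) - starRingEnd ℂ I * inner ℂ (w : H) (d : H) =
        inner ℂ p.2 (d : H) - starRingEnd ℂ I * inner ℂ p.1 (d : H) := by
      rw [← inner_smul_left, ← inner_smul_left, ← inner_sub_left, ← inner_sub_left, hAw]
    have hw'' : A d - starRingEnd ℂ I • (d : H) = p.1 - w := hw'
    rw [← inner_self_eq_zero (𝕜 := ℂ)]
    nth_rewrite 2 [← hw'']
    rw [inner_sub_right, inner_smul_right, inner_sub_left, inner_sub_left, ← e1, ← e2]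
    linear_combination -e3
  have h1 : p.1 = w := sub_eq_zero.1 hzero
  rw [LinearPMap.mem_graph_iff]
  refine ⟨w, h1.symm, ?_⟩
  rw [h1] at hAw
  exact sub_left_injective hAw

end resolvents

/-! ### Functional calculus of a self-adjoint operator -/

section functions

/-- The point `i (1 + u) / (1 - u)` of the real line which corresponds to `u` on the circle. -/
def cayleyCoord (u : ℂ) : ℝ := (I * (1 + u) / (1 - u)).re

/-- The function on the circle which corresponds to a function on the line, extended by `0` to the
point `1`. -/
def onCircle (φ : ℝ → ℂ) (u : ℂ) : ℂ := if u = 1 then 0 else φ (cayleyCoord u)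

/-- On the circle `ū = u⁻¹`, so `i(1 + u)/(1 - u)` is already real and the real part in
`cayleyCoord` loses nothing. -/
theorem cayleyCoord_add_I {u : ℂ} (hu : ‖u‖ = 1) (h1 : u ≠ 1) :
    (cayleyCoord u : ℂ) + I = 2 * I / (1 - u) := by
  have h0 : 1 - u ≠ 0 := sub_ne_zero.2 h1.symm
  have hu0 : u ≠ 0 := by rintro rfl; simp at hu
  have hc : starRingEnd ℂ u = u⁻¹ := (Complex.inv_eq_conj hu).symm
  have hreal : ((cayleyCoord u : ℝ) : ℂ) = I * (1 + u) / (1 - u) := by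
    rw [cayleyCoord, ← Complex.conj_eq_iff_re]
    simp only [map_div₀, map_mul, map_add, map_sub, map_one, Complex.conj_I, hc]
    have h2 : 1 - u⁻¹ ≠ 0 := by
      rw [sub_ne_zero]
      exact fun h => h1 (inv_eq_one.1 h.symm)
    rw [div_eq_div_iff h2 h0]
    field_simp
    ring
  rw [hreal]
  field_simp
  ring

theorem one_sub_eq {u : ℂ} (hu : ‖u‖ = 1) (h1 : u ≠ 1) :
    (1 - u) / (2 * I) = ((cayleyCoord u : ℂ) + I)⁻¹ := by
  rw [cayleyCoord_add_I hu h1, inv_div]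

theorem normSq_add_I (x : ℝ) : Complex.normSq ((x : ℂ) + I) = x ^ 2 + 1 := by
  simp [Complex.normSq_apply]
  ring

/-- Translates decay like `(x² + 1)⁻¹` at infinity into vanishing like `|1 - u|²` at the point `1`.
-/
theorem norm_one_sub_sq {u : ℂ} (hu : ‖u‖ = 1) (h1 : u ≠ 1) :
    ‖1 - u‖ ^ 2 / 4 = (cayleyCoord u ^ 2 + 1)⁻¹ := by
  have h := congrArg (fun w => ‖w‖ ^ 2) (one_sub_eq hu h1)
  simp only [norm_div, norm_mul, norm_inv, Complex.norm_I, div_pow, inv_pow,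
    ← Complex.normSq_eq_norm_sq ((cayleyCoord u : ℂ) + I), normSq_add_I] at h
  rw [← h]
  norm_num

/-- Continuous functions which are `O((x² + 1)⁻¹)`. -/
structure IsDecaying (h : ℝ → ℂ) : Prop where
  continuous : Continuous h
  bound : ∃ c, ∀ x, ‖h x‖ ≤ c * (x ^ 2 + 1)⁻¹

/-- Bounded continuous functions. -/
structure IsBddCont (f : ℝ → ℂ) : Prop where
  continuous : Continuous f
  bound : ∃ c, ∀ x, ‖f x‖ ≤ c

/-- The function `(x² + 1)⁻¹`. -/
def decay (x : ℝ) : ℂ := ((x ^ 2 + 1 : ℝ) : ℂ)⁻¹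

theorem norm_decay (x : ℝ) : ‖decay x‖ = (x ^ 2 + 1)⁻¹ := by
  rw [decay, norm_inv, Complex.norm_real, Real.norm_of_nonneg (by positivity)]

theorem star_decay (x : ℝ) : star (decay x) = decay x := by
  simp [decay]

theorem continuous_decay : Continuous decay := by
  unfold decay
  refine Continuous.inv₀ (by fun_prop) fun x => ?_
  exact_mod_cast (by positivity : x ^ 2 + 1 ≠ 0)

theorem isDecaying_decay : IsDecaying decay :=
  ⟨continuous_decay, 1, fun x => by rw [norm_decay, one_mul]⟩

theorem IsBddCont.mul_isDecaying {f h : ℝ → ℂ} (hf : IsBddCont f) (hh : IsDecaying h) :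
    IsDecaying fun x => f x * h x := by
  obtain ⟨c, hc⟩ := hf.bound
  obtain ⟨d, hd⟩ := hh.bound
  refine ⟨hf.continuous.mul hh.continuous, c * d, fun x => ?_⟩
  rw [norm_mul, mul_assoc]
  exact mul_le_mul (hc x) (hd x) (norm_nonneg _) ((norm_nonneg _).trans (hc x))

theorem IsDecaying.isBddCont {h : ℝ → ℂ} (hh : IsDecaying h) : IsBddCont h := by
  obtain ⟨d, hd⟩ := hh.bound
  refine ⟨hh.continuous, d, fun x => (hd x).trans ?_⟩
  have hd0 : 0 ≤ d := by
    have := (norm_nonneg _).trans (hd 0)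
    simpa using this
  exact mul_le_of_le_one_right hd0 (inv_le_one_of_one_le₀ (by nlinarith [sq_nonneg x]))

theorem IsDecaying.mul {f h : ℝ → ℂ} (hf : IsDecaying f) (hh : IsDecaying h) :
    IsDecaying fun x => f x * h x := hf.isBddCont.mul_isDecaying hh

theorem IsDecaying.star {h : ℝ → ℂ} (hh : IsDecaying h) : IsDecaying fun x => star (h x) := by
  obtain ⟨d, hd⟩ := hh.bound
  exact ⟨hh.continuous.star, d, fun x => by rw [norm_star]; exact hd x⟩

theorem isDecaying_of_hasCompactSupport {φ : ℝ → ℂ} (h1 : Continuous φ)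
    (h2 : HasCompactSupport φ) : IsDecaying φ := by
  have h3 : Continuous fun x : ℝ => φ x * ((x ^ 2 + 1 : ℝ) : ℂ) := by fun_prop
  obtain ⟨c, hc⟩ := h3.bounded_above_of_compact_support h2.mul_right
  refine ⟨h1, c, fun x => ?_⟩
  have hx : 0 < x ^ 2 + 1 := by positivity
  have := hc x
  rw [norm_mul, Complex.norm_real, Real.norm_of_nonneg hx.le] at this
  rwa [← div_eq_mul_inv, le_div_iff₀ hx]

theorem isBddCont_const (c : ℂ) : IsBddCont fun _ => c := ⟨continuous_const, ‖c‖, fun _ => le_rfl⟩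

theorem IsBddCont.add {f g : ℝ → ℂ} (hf : IsBddCont f) (hg : IsBddCont g) :
    IsBddCont fun x => f x + g x := by
  obtain ⟨c, hc⟩ := hf.bound
  obtain ⟨d, hd⟩ := hg.bound
  exact ⟨hf.continuous.add hg.continuous, c + d,
    fun x => (norm_add_le _ _).trans (add_le_add (hc x) (hd x))⟩

theorem IsBddCont.mul {f g : ℝ → ℂ} (hf : IsBddCont f) (hg : IsBddCont g) :
    IsBddCont fun x => f x * g x := by
  obtain ⟨c, hc⟩ := hf.bound
  obtain ⟨d, hd⟩ := hg.bound
  refine ⟨hf.continuous.mul hg.continuous, c * d, fun x => ?_⟩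
  rw [norm_mul]
  exact mul_le_mul (hc x) (hd x) (norm_nonneg _) ((norm_nonneg _).trans (hc x))

theorem IsBddCont.star {f : ℝ → ℂ} (hf : IsBddCont f) : IsBddCont fun x => star (f x) := by
  obtain ⟨c, hc⟩ := hf.bound
  exact ⟨hf.continuous.star, c, fun x => by rw [norm_star]; exact hc x⟩

theorem ofReal_sub_ne_zero {z : ℂ} (hz : z.im ≠ 0) (x : ℝ) : (x : ℂ) - z ≠ 0 := by
  intro h
  have := congrArg Complex.im h
  simp at this
  exact hz this

theorem abs_im_le_norm_sub (z : ℂ) (x : ℝ) : |z.im| ≤ ‖(x : ℂ) - z‖ := by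
  have := Complex.abs_im_le_norm ((x : ℂ) - z)
  simpa using this

theorem isBddCont_inv_sub {z : ℂ} (hz : z.im ≠ 0) : IsBddCont fun x => ((x : ℂ) - z)⁻¹ := by
  refine ⟨Continuous.inv₀ (by fun_prop) (ofReal_sub_ne_zero hz), |z.im|⁻¹, fun x => ?_⟩
  rw [norm_inv]
  exact inv_anti₀ (abs_pos.2 hz) (abs_im_le_norm_sub z x)

theorem isBddCont_abs_add_one_div {z : ℂ} (hz : z.im ≠ 0) :
    IsBddCont fun x => (((|x| : ℝ) : ℂ) + 1) / ((x : ℂ) - z) := by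
  have hpos := abs_pos.2 hz
  refine ⟨Continuous.div (by fun_prop) (by fun_prop) (ofReal_sub_ne_zero hz),
    -- The constant comes from `|x| ≤ |x - z| + |z|` and `1 ≤ |x - z| / |Im z|`.
    1 + (‖z‖ + 1) / |z.im|, fun x => ?_⟩
  have h1 := abs_im_le_norm_sub z x
  have h2 : ‖((|x| : ℝ) : ℂ) + 1‖ = |x| + 1 := by
    have : ((|x| : ℝ) : ℂ) + 1 = ((|x| + 1 : ℝ) : ℂ) := by push_cast; rfl
    rw [this, Complex.norm_real, Real.norm_of_nonneg (by positivity)]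
  have h3 : |x| ≤ ‖(x : ℂ) - z‖ + ‖z‖ := by
    have := norm_add_le ((x : ℂ) - z) z
    rwa [sub_add_cancel, Complex.norm_real, Real.norm_eq_abs] at this
  rw [norm_div, h2, div_le_iff₀ (hpos.trans_le h1)]
  calc |x| + 1 ≤ ‖(x : ℂ) - z‖ + (‖z‖ + 1) * 1 := by linarith
    _ ≤ ‖(x : ℂ) - z‖ + (‖z‖ + 1) * (‖(x : ℂ) - z‖ / |z.im|) := by
        gcongr
        rwa [one_le_div hpos]
    _ = _ := by ring

/-- The function `(|x| + 1)^{-1/2}`. -/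
def invSqrtFun (x : ℝ) : ℂ := ((Real.sqrt (|x| + 1) : ℝ) : ℂ)⁻¹

theorem sqrt_abs_add_one_pos (x : ℝ) : 0 < Real.sqrt (|x| + 1) := Real.sqrt_pos.2 (by positivity)

theorem invSqrtFun_sq (x : ℝ) : (((|x| : ℝ) : ℂ) + 1) * (invSqrtFun x * invSqrtFun x) = 1 := by
  have h : ((Real.sqrt (|x| + 1) : ℝ) : ℂ) * ((Real.sqrt (|x| + 1) : ℝ) : ℂ) =
      ((|x| : ℝ) : ℂ) + 1 := by
    rw [← Complex.ofReal_mul, Real.mul_self_sqrt (by positivity)]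
    push_cast
    rfl
  rw [invSqrtFun, ← mul_inv, h, mul_inv_cancel₀]
  have : ((|x| : ℝ) : ℂ) + 1 = ((|x| + 1 : ℝ) : ℂ) := by push_cast; rfl
  rw [this]
  exact_mod_cast (by positivity : |x| + 1 ≠ 0)

theorem star_invSqrtFun (x : ℝ) : star (invSqrtFun x) = invSqrtFun x := by
  simp [invSqrtFun]

theorem isBddCont_invSqrtFun : IsBddCont invSqrtFun := by
  unfold invSqrtFun
  refine ⟨Continuous.inv₀ (by fun_prop) fun x => ?_, 1, fun x => ?_⟩
  · exact_mod_cast (sqrt_abs_add_one_pos x).ne'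
  · rw [norm_inv, Complex.norm_real, Real.norm_of_nonneg (Real.sqrt_nonneg _)]
    refine inv_le_one_of_one_le₀ (Real.one_le_sqrt.2 ?_)
    linarith [abs_nonneg x]

/-- The decay of `h` squeezes the transplanted function to `0` at `u = 1`. Continuity there is what
lets `cfc` be used, since `cfc` is `0` by default on functions discontinuous on the spectrum. -/
theorem continuousOn_onCircle {h : ℝ → ℂ} (hh : IsDecaying h) :
    ContinuousOn (onCircle h) {u | ‖u‖ = 1} := by
  intro u hu
  by_cases h1 : u = 1
  · obtain ⟨c, hc⟩ := hh.bound
    subst h1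
    have h0 : onCircle h 1 = 0 := by simp [onCircle]
    rw [ContinuousWithinAt, h0]
    have hlim : Filter.Tendsto (fun v : ℂ => c * (‖1 - v‖ ^ 2 / 4)) (𝓝[{u | ‖u‖ = 1}] 1) (𝓝 0) := by
      have : ContinuousAt (fun v : ℂ => c * (‖1 - v‖ ^ 2 / 4)) 1 := by fun_prop
      have h2 := this.tendsto
      simp only [sub_self, norm_zero] at h2
      norm_num at h2
      exact h2.mono_left nhdsWithin_le_nhds
    refine squeeze_zero_norm' ?_ hlim
    filter_upwards [self_mem_nhdsWithin] with v hv
    by_cases hv1 : v = 1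
    · simp [onCircle, hv1]
    · rw [onCircle, if_neg hv1, norm_one_sub_sq hv hv1]
      exact hc _
  · have h0 : 1 - u ≠ 0 := sub_ne_zero.2 (Ne.symm h1)
    have hx : ContinuousAt cayleyCoord u := by
      unfold cayleyCoord
      refine Complex.continuous_re.continuousAt.comp ?_
      exact ContinuousAt.div (by fun_prop) (by fun_prop) h0
    have h2 : ContinuousAt (fun v => h (cayleyCoord v)) u :=
      ContinuousAt.comp hh.continuous.continuousAt hx
    refine (h2.congr ?_).continuousWithinAt
    filter_upwards [isOpen_ne.mem_nhds h1] with v hv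
    rw [onCircle, if_neg hv]

end functions

/-! ### Bounded continuous functions of a self-adjoint operator, by way of its Cayley transform -/

section calculus

variable {H : Type*} [NormedAddCommGroup H] [InnerProductSpace ℂ H] [CompleteSpace H]

theorem I_im_ne_zero : (-I : ℂ).im ≠ 0 := by simp

theorem cayley_mem_unitary {A : H →ₗ.[ℂ] H} (hA : IsSelfAdjoint A) :
    cayley A ∈ unitary (H →L[ℂ] H) := by
  have h := one_add_res_mem_unitary hA I_im_ne_zero
  have h2 : cayley A = 1 + (-I - starRingEnd ℂ (-I)) • res A (-I) := by
    rw [cayley, map_neg, Complex.conj_I]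
    module
  rwa [h2]

theorem isStarNormal_cayley {A : H →ₗ.[ℂ] H} (hA : IsSelfAdjoint A) : IsStarNormal (cayley A) :=
  ⟨by
    have h := Unitary.mem_iff.1 (cayley_mem_unitary hA)
    rw [Commute, SemiconjBy, h.1, h.2]⟩

theorem spectrum_cayley_subset {A : H →ₗ.[ℂ] H} (hA : IsSelfAdjoint A) :
    spectrum ℂ (cayley A) ⊆ {u | ‖u‖ = 1} := by
  have h := cayley_mem_unitary hA
  generalize cayley A = W at h ⊢
  intro u hu
  rw [Set.mem_ofPred_eq]
  exact spectrum.norm_eq_one_of_unitary h hu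

theorem continuousOn_onCircle_spectrum {A : H →ₗ.[ℂ] H} (hA : IsSelfAdjoint A) {h : ℝ → ℂ}
    (hh : IsDecaying h) : ContinuousOn (onCircle h) (spectrum ℂ (cayley A)) :=
  (continuousOn_onCircle hh).mono (spectrum_cayley_subset hA)

theorem funcCc_eq (A : H →ₗ.[ℂ] H) (h : ℝ → ℂ) : funcCc A h = cfc (onCircle h) (cayley A) := rfl

theorem funcCc_mul {A : H →ₗ.[ℂ] H} (hA : IsSelfAdjoint A) {f g : ℝ → ℂ} (hf : IsDecaying f)
    (hg : IsDecaying g) : funcCc A f * funcCc A g = funcCc A fun x => f x * g x := by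
  rw [funcCc_eq, funcCc_eq, funcCc_eq, ← cfc_mul _ _ _ (continuousOn_onCircle_spectrum hA hf)
    (continuousOn_onCircle_spectrum hA hg)]
  congr 1
  ext u
  by_cases hu : u = 1 <;> simp [onCircle, hu]

theorem funcCc_add {A : H →ₗ.[ℂ] H} (hA : IsSelfAdjoint A) {f g : ℝ → ℂ} (hf : IsDecaying f)
    (hg : IsDecaying g) : funcCc A f + funcCc A g = funcCc A fun x => f x + g x := by
  rw [funcCc_eq, funcCc_eq, funcCc_eq, ← cfc_add _ _ _ (continuousOn_onCircle_spectrum hA hf)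
    (continuousOn_onCircle_spectrum hA hg)]
  congr 1
  ext u
  by_cases hu : u = 1 <;> simp [onCircle, hu]

theorem funcCc_const_mul {A : H →ₗ.[ℂ] H} (hA : IsSelfAdjoint A) {f : ℝ → ℂ} (hf : IsDecaying f)
    (c : ℂ) : c • funcCc A f = funcCc A fun x => c * f x := by
  rw [funcCc_eq, funcCc_eq, ← cfc_const_mul _ _ _ (continuousOn_onCircle_spectrum hA hf)]
  congr 1
  ext u
  by_cases hu : u = 1 <;> simp [onCircle, hu]

theorem funcCc_star (A : H →ₗ.[ℂ] H) (f : ℝ → ℂ) :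
    star (funcCc A f) = funcCc A fun x => star (f x) := by
  rw [funcCc_eq, funcCc_eq, ← cfc_star]
  congr 1
  ext u
  by_cases hu : u = 1 <;> simp [onCircle, hu]

theorem norm_funcCc_le (A : H →ₗ.[ℂ] H) {f : ℝ → ℂ} {c : ℝ} (hc : 0 ≤ c) (hf : ∀ x, ‖f x‖ ≤ c) :
    ‖funcCc A f‖ ≤ c := by
  rw [funcCc_eq]
  refine norm_cfc_le hc fun u _ => ?_
  by_cases hu : u = 1
  · simpa [onCircle, hu] using hc
  · simpa [onCircle, hu] using hf _

theorem res_eq_cfc {A : H →ₗ.[ℂ] H} (hA : IsSelfAdjoint A) :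
    res A (-I) = cfc (fun u : ℂ => (1 - u) / (2 * I)) (cayley A) := by
  have := isStarNormal_cayley hA
  have h1 : cfc (fun u : ℂ => (2 * I)⁻¹ * (1 - u)) (cayley A) = (2 * I)⁻¹ • (1 - cayley A) := by
    rw [cfc_const_mul _ _ _ (by fun_prop), cfc_sub (fun _ : ℂ => (1 : ℂ)) (fun u => u),
      cfc_const_one ℂ (cayley A), cfc_id' ℂ (cayley A)]
  have h2 : (fun u : ℂ => (1 - u) / (2 * I)) = fun u => (2 * I)⁻¹ * (1 - u) := by
    ext u
    rw [div_eq_inv_mul]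
  rw [h2, h1, cayley, sub_sub_cancel, smul_smul, inv_mul_cancel₀ (by simp), one_smul]

theorem res_mul_funcCc {A : H →ₗ.[ℂ] H} (hA : IsSelfAdjoint A) {h : ℝ → ℂ} (hh : IsDecaying h) :
    res A (-I) * funcCc A h = funcCc A fun x => ((x : ℂ) + I)⁻¹ * h x := by
  rw [res_eq_cfc hA, funcCc_eq, funcCc_eq, ← cfc_mul _ _ _ (by fun_prop)
    (continuousOn_onCircle_spectrum hA hh)]
  refine cfc_congr fun u hu => ?_
  by_cases h1 : u = 1
  · simp [onCircle, h1]
  · simp only [onCircle, h1, if_false, one_sub_eq (spectrum_cayley_subset hA hu) h1]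

/-- `(x² + 1)⁻¹ = |(x + i)⁻¹|²`. In this form `decay(A)` is visibly injective and, being
self-adjoint, has dense range; it serves as the regularizer for functions that do not vanish at
infinity. -/
theorem funcCc_decay {A : H →ₗ.[ℂ] H} (hA : IsSelfAdjoint A) :
    funcCc A decay = star (res A (-I)) * res A (-I) := by
  have := isStarNormal_cayley hA
  have hc : ContinuousOn (fun u : ℂ => star ((1 - u) / (2 * I))) (spectrum ℂ (cayley A)) :=
    Continuous.continuousOn (by fun_prop)
  rw [res_eq_cfc hA, funcCc_eq, ← cfc_star, ← cfc_mul _ _ _ hc (by fun_prop)]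
  refine cfc_congr fun u hu => ?_
  by_cases h1 : u = 1
  · simp [onCircle, h1]
  · simp only [onCircle, h1, if_false, one_sub_eq (spectrum_cayley_subset hA hu) h1]
    rw [decay, Complex.star_def, Complex.conj_mul', norm_inv, ← normSq_add_I,
      Complex.normSq_eq_norm_sq]
    push_cast
    rw [inv_pow]

theorem funcCc_decay_injective {A : H →ₗ.[ℂ] H} (hA : IsSelfAdjoint A) {x : H}
    (hx : funcCc A decay x = 0) : x = 0 := by
  have h1 : res A (-I) x = 0 := by
    rw [← inner_self_eq_zero (𝕜 := ℂ), ← ContinuousLinearMap.adjoint_inner_right,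
      ← ContinuousLinearMap.star_eq_adjoint, ← mul_apply_eq_comp, ← funcCc_decay hA, hx,
      inner_zero_right]
  exact (hA.isResolventAt_res I_im_ne_zero).eq_zero h1

theorem star_funcCc_decay (A : H →ₗ.[ℂ] H) : star (funcCc A decay) = funcCc A decay := by
  rw [funcCc_star]
  simp only [star_decay]

theorem denseRange_funcCc_decay {A : H →ₗ.[ℂ] H} (hA : IsSelfAdjoint A) :
    DenseRange (funcCc A decay) := by
  have h : Dense ((funcCc A decay).range : Set H) := by
    rw [Submodule.dense_iff_topologicalClosure_eq_top, Submodule.topologicalClosure_eq_top_iff,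
      ContinuousLinearMap.orthogonal_range, ← ContinuousLinearMap.star_eq_adjoint,
      star_funcCc_decay]
    exact LinearMap.ker_eq_bot'.2 fun x hx => funcCc_decay_injective hA hx
  rwa [LinearMap.coe_range] at h

/-- Identities in the bounded calculus are checked after multiplication by `decay(A)`, where
everything is a `cfc` of a continuous function. -/
theorem funcCc_decay_mul_left_cancel {A : H →ₗ.[ℂ] H} (hA : IsSelfAdjoint A) {V W : H →L[ℂ] H}
    (h : funcCc A decay * V = funcCc A decay * W) : V = W := by
  ext x
  have h1 := congrArg (fun T : H →L[ℂ] H => T x) h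
  simp only [mul_apply_eq_comp] at h1
  rw [← sub_eq_zero, ← map_sub] at h1
  exact sub_eq_zero.1 (funcCc_decay_injective hA h1)

theorem funcCc_decay_mul_right_cancel {A : H →ₗ.[ℂ] H} (hA : IsSelfAdjoint A) {V W : H →L[ℂ] H}
    (h : V * funcCc A decay = W * funcCc A decay) : V = W := by
  apply star_injective
  apply funcCc_decay_mul_left_cancel hA
  rw [← star_funcCc_decay, ← star_mul, ← star_mul, h]

/-- `f(A)` for a self-adjoint operator `A` and a bounded continuous function `f`. -/
def bddFunc (A : H →ₗ.[ℂ] H) (f : ℝ → ℂ) : H →L[ℂ] H :=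
  (funcCc A (fun x => f x * decay x) : H →ₗ[ℂ] H).extendOfNorm (funcCc A decay : H →ₗ[ℂ] H)

/-- If `|f| ≤ c`, put `g = (c² - |f|²)^{1/2}`; then `|f|² + |g|² = c²` yields `‖(f·decay)(A)x‖² +
‖(g·decay)(A)x‖² = c²‖decay(A)x‖²`. The bound makes the extension by density defining `bddFunc`
legitimate. -/
theorem norm_funcCc_mul_decay_le {A : H →ₗ.[ℂ] H} (hA : IsSelfAdjoint A) {f : ℝ → ℂ}
    (hf : IsBddCont f) : ∃ c, ∀ x, ‖funcCc A (fun x => f x * decay x) x‖ ≤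
      c * ‖funcCc A decay x‖ := by
  obtain ⟨c, hc⟩ := hf.bound
  have hc0 : 0 ≤ c := (norm_nonneg _).trans (hc 0)
  refine ⟨c, fun x => ?_⟩
  let g : ℝ → ℂ := fun x => ((Real.sqrt (c ^ 2 - ‖f x‖ ^ 2) : ℝ) : ℂ)
  have hg : IsBddCont g := by
    refine ⟨?_, c, fun x => ?_⟩
    · have := hf.continuous
      fun_prop
    · rw [Complex.norm_real, Real.norm_of_nonneg (Real.sqrt_nonneg _)]
      exact (Real.sqrt_le_left hc0).2 (by nlinarith [sq_nonneg ‖f x‖])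
  have hfd := hf.mul_isDecaying isDecaying_decay
  have hgd := hg.mul_isDecaying isDecaying_decay
  have hsq : ∀ {h : ℝ → ℂ}, IsDecaying h →
      ‖funcCc A h x‖ ^ 2 = (inner ℂ x (funcCc A (fun x => star (h x) * h x) x)).re := by
    intro h hh
    rw [← funcCc_mul hA hh.star hh, ← funcCc_star, mul_apply_eq_comp,
      ContinuousLinearMap.star_eq_adjoint, ContinuousLinearMap.adjoint_inner_right,
      inner_self_eq_norm_sq_to_K]
    norm_cast
  have key : ‖funcCc A (fun x => f x * decay x) x‖ ^ 2 + ‖funcCc A (fun x => g x * decay x) x‖ ^ 2 =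
      ‖funcCc A (fun x => (c : ℂ) * decay x) x‖ ^ 2 := by
    have hcd := (isBddCont_const (c : ℂ)).mul_isDecaying isDecaying_decay
    rw [hsq hfd, hsq hgd, hsq hcd, ← Complex.add_re, ← inner_add_right, ← add_apply,
      funcCc_add hA (hfd.star.mul hfd) (hgd.star.mul hgd)]
    congr 5
    ext y
    have e1 : star (f y) * f y = ((‖f y‖ ^ 2 : ℝ) : ℂ) := by
      rw [Complex.star_def, Complex.conj_mul']; push_cast; rfl
    have e2 : star (g y) * g y = ((c ^ 2 - ‖f y‖ ^ 2 : ℝ) : ℂ) := by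
      rw [Complex.star_def, Complex.conj_ofReal, ← Complex.ofReal_mul, Real.mul_self_sqrt]
      have := pow_le_pow_left₀ (norm_nonneg _) (hc y) 2
      linarith
    have e3 : star (c : ℂ) = c := by rw [Complex.star_def, Complex.conj_ofReal]
    simp only [star_mul, star_decay, e3]
    push_cast at e1 e2
    linear_combination (decay y) ^ 2 * (e1 + e2)
  rw [← funcCc_const_mul hA isDecaying_decay, smul_apply, norm_smul, Complex.norm_real,
    Real.norm_of_nonneg hc0] at key
  refine le_of_sq_le_sq ?_ (by positivity)
  nlinarith [sq_nonneg ‖funcCc A (fun x => g x * decay x) x‖]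

theorem bddFunc_mul_decay {A : H →ₗ.[ℂ] H} (hA : IsSelfAdjoint A) {f : ℝ → ℂ} (hf : IsBddCont f) :
    bddFunc A f * funcCc A decay = funcCc A fun x => f x * decay x := by
  ext x
  exact LinearMap.extendOfNorm_eq (denseRange_funcCc_decay hA) (norm_funcCc_mul_decay_le hA hf) x

/-- The dense range of `decay(A)` makes this a characterization; the algebraic rules of the calculus
follow from it by uniqueness. -/
theorem eq_bddFunc {A : H →ₗ.[ℂ] H} (hA : IsSelfAdjoint A) {f : ℝ → ℂ} (hf : IsBddCont f)
    {V : H →L[ℂ] H} (h : V * funcCc A decay = funcCc A fun x => f x * decay x) :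
    V = bddFunc A f := by
  apply funcCc_decay_mul_right_cancel hA
  rw [h, bddFunc_mul_decay hA hf]

theorem funcCc_mul_bddFunc {A : H →ₗ.[ℂ] H} (hA : IsSelfAdjoint A) {f φ : ℝ → ℂ}
    (hf : IsBddCont f) (hφ : IsDecaying φ) :
    funcCc A φ * bddFunc A f = funcCc A fun x => φ x * f x := by
  have h1 : (fun x => φ x * f x) = fun x => f x * φ x := funext fun x => mul_comm _ _
  apply funcCc_decay_mul_right_cancel hA
  rw [mul_assoc, bddFunc_mul_decay hA hf, funcCc_mul hA hφ (hf.mul_isDecaying isDecaying_decay),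
    h1, funcCc_mul hA (hf.mul_isDecaying hφ) isDecaying_decay]
  congr 1
  ext x
  ring

theorem bddFunc_mul_funcCc {A : H →ₗ.[ℂ] H} (hA : IsSelfAdjoint A) {f φ : ℝ → ℂ}
    (hf : IsBddCont f) (hφ : IsDecaying φ) :
    bddFunc A f * funcCc A φ = funcCc A fun x => f x * φ x := by
  have h1 : (fun x => decay x * f x) = fun x => f x * decay x := funext fun x => mul_comm _ _
  apply funcCc_decay_mul_left_cancel hA
  rw [← mul_assoc, funcCc_mul_bddFunc hA hf isDecaying_decay, h1,
    funcCc_mul hA (hf.mul_isDecaying isDecaying_decay) hφ,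
    funcCc_mul hA isDecaying_decay (hf.mul_isDecaying hφ)]
  congr 1
  ext x
  ring

theorem bddFunc_mul {A : H →ₗ.[ℂ] H} (hA : IsSelfAdjoint A) {f g : ℝ → ℂ} (hf : IsBddCont f)
    (hg : IsBddCont g) : bddFunc A f * bddFunc A g = bddFunc A fun x => f x * g x := by
  apply eq_bddFunc hA (hf.mul hg)
  rw [mul_assoc, bddFunc_mul_decay hA hg,
    bddFunc_mul_funcCc hA hf (hg.mul_isDecaying isDecaying_decay)]
  simp only [mul_assoc]

theorem bddFunc_add {A : H →ₗ.[ℂ] H} (hA : IsSelfAdjoint A) {f g : ℝ → ℂ} (hf : IsBddCont f)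
    (hg : IsBddCont g) : bddFunc A f + bddFunc A g = bddFunc A fun x => f x + g x := by
  apply eq_bddFunc hA (hf.add hg)
  rw [add_mul, bddFunc_mul_decay hA hf, bddFunc_mul_decay hA hg, funcCc_add hA
    (hf.mul_isDecaying isDecaying_decay) (hg.mul_isDecaying isDecaying_decay)]
  simp only [add_mul]

theorem bddFunc_const_mul {A : H →ₗ.[ℂ] H} (hA : IsSelfAdjoint A) {f : ℝ → ℂ} (hf : IsBddCont f)
    (c : ℂ) : c • bddFunc A f = bddFunc A fun x => c * f x := by
  apply eq_bddFunc hA ((isBddCont_const c).mul hf)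
  rw [smul_mul_assoc, bddFunc_mul_decay hA hf,
    funcCc_const_mul hA (hf.mul_isDecaying isDecaying_decay)]
  simp only [mul_assoc]

theorem bddFunc_const {A : H →ₗ.[ℂ] H} (hA : IsSelfAdjoint A) (c : ℂ) :
    bddFunc A (fun _ => c) = c • 1 := by
  symm
  apply eq_bddFunc hA (isBddCont_const c)
  rw [smul_mul_assoc, one_mul, funcCc_const_mul hA isDecaying_decay]

theorem star_bddFunc {A : H →ₗ.[ℂ] H} (hA : IsSelfAdjoint A) {f : ℝ → ℂ} (hf : IsBddCont f) :
    star (bddFunc A f) = bddFunc A fun x => star (f x) := by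
  apply eq_bddFunc hA hf.star
  rw [← star_funcCc_decay, ← star_mul, funcCc_mul_bddFunc hA hf isDecaying_decay, funcCc_star]
  congr 1
  ext x
  rw [star_mul, star_decay]

theorem res_eq_bddFunc {A : H →ₗ.[ℂ] H} (hA : IsSelfAdjoint A) {z : ℂ} (hz : z.im ≠ 0) :
    res A z = bddFunc A fun x => ((x : ℂ) - z)⁻¹ := by
  have hi := isBddCont_inv_sub I_im_ne_zero
  have h1 : res A (-I) = bddFunc A fun x => ((x : ℂ) - -I)⁻¹ := by
    apply eq_bddFunc hA hi
    rw [res_mul_funcCc hA isDecaying_decay]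
    simp only [sub_neg_eq_add]
  have h2 := (hA.isResolventAt_res hz).sub_eq (hA.isResolventAt_res I_im_ne_zero)
  -- Here `g = (x - z)/(x + i)` and `h = (x + i)/(x - z) = g⁻¹`, written so as to be visibly
  -- bounded. They carry the formula from the point `-i`, where the Cayley transform gives it, to
  -- `z`.
  set g : ℝ → ℂ := fun x => 1 + -(z + I) * ((x : ℂ) - -I)⁻¹
  set h : ℝ → ℂ := fun x => 1 + (z + I) * ((x : ℂ) - z)⁻¹
  have hg : IsBddCont g := (isBddCont_const 1).add ((isBddCont_const _).mul hi)
  have hh : IsBddCont h :=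
    (isBddCont_const 1).add ((isBddCont_const _).mul (isBddCont_inv_sub hz))
  have h3 : res A z * bddFunc A g = res A (-I) := by
    have : bddFunc A g = 1 + -(z + I) • res A (-I) := by
      rw [h1, bddFunc_const_mul hA hi, ← one_smul ℂ (1 : H →L[ℂ] H), ← bddFunc_const hA,
        bddFunc_add hA (isBddCont_const 1) ((isBddCont_const _).mul hi)]
    rw [this, mul_add, mul_one, mul_smul_comm]
    linear_combination (norm := module) h2
  have hne : ∀ x : ℝ, (x : ℂ) - z ≠ 0 := ofReal_sub_ne_zero hz
  have hne' : ∀ x : ℝ, (x : ℂ) - -I ≠ 0 := ofReal_sub_ne_zero I_im_ne_zero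
  have h4 : bddFunc A g * bddFunc A h = 1 := by
    rw [bddFunc_mul hA hg hh, ← one_smul ℂ (1 : H →L[ℂ] H), ← bddFunc_const hA]
    congr 1
    ext x
    have := hne x
    have := hne' x
    simp only [g, h]
    field_simp
    ring
  rw [← mul_one (res A z), ← h4, ← mul_assoc, h3, h1, bddFunc_mul hA hi hh]
  congr 1
  ext x
  have := hne x
  have := hne' x
  simp only [h]
  field_simp
  ring

/-- The truncations `(decay - δ)₊` have compact support and are within `δ` of `decay`, so `decay(A)y
= 0` in the limit, and `decay(A)` is injective. -/
theorem eq_zero_of_funcCc_eq_zero {A : H →ₗ.[ℂ] H} (hA : IsSelfAdjoint A) {y : H}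
    (h : ∀ φ : ℝ → ℂ, Continuous φ → HasCompactSupport φ → funcCc A φ y = 0) : y = 0 := by
  apply funcCc_decay_injective hA
  rw [← norm_le_zero_iff]
  refine le_of_forall_pos_le_add fun ε hε => ?_
  obtain ⟨δ, hδ, hδε⟩ : ∃ δ > 0, δ * ‖y‖ ≤ ε := by
    refine ⟨ε / (‖y‖ + 1), by positivity, ?_⟩
    rw [div_mul_eq_mul_div, div_le_iff₀ (by positivity)]
    nlinarith [norm_nonneg y]
  let φ : ℝ → ℂ := fun x => ((max ((x ^ 2 + 1)⁻¹ - δ) 0 : ℝ) : ℂ)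
  have hcont : Continuous φ := by
    have h1 : Continuous fun x : ℝ => (x ^ 2 + 1)⁻¹ :=
      Continuous.inv₀ (by fun_prop) fun x => by positivity
    fun_prop
  have hcpt : HasCompactSupport φ := by
    refine HasCompactSupport.of_support_subset_isCompact
      (isCompact_Icc (a := -(δ⁻¹ + 1)) (b := δ⁻¹ + 1)) fun x hx => ?_
    have h1 : δ < (x ^ 2 + 1)⁻¹ := by
      by_contra hle
      refine hx ?_
      simp only [φ, max_eq_right (sub_nonpos.2 (not_lt.1 hle)), Complex.ofReal_zero]
    have h2 : x ^ 2 + 1 < δ⁻¹ := by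
      rwa [lt_inv_comm₀ hδ (by positivity)] at h1
    rw [Set.mem_Icc, ← abs_le]
    refine abs_le_of_sq_le_sq ?_ (by positivity)
    nlinarith [inv_pos.2 hδ]
  have hdφ := isDecaying_of_hasCompactSupport hcont hcpt
  have hneg := (isBddCont_const (-1)).mul_isDecaying hdφ
  have hle : ‖funcCc A (fun x => decay x + -1 * φ x)‖ ≤ δ := by
    refine norm_funcCc_le A hδ.le fun x => ?_
    have : decay x + -1 * φ x = (((x ^ 2 + 1)⁻¹ - max ((x ^ 2 + 1)⁻¹ - δ) 0 : ℝ) : ℂ) := by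
      simp only [decay, φ]
      push_cast
      ring
    rw [this, Complex.norm_real, Real.norm_eq_abs, abs_le]
    have h0 : 0 < (x ^ 2 + 1)⁻¹ := by positivity
    rcases max_cases ((x ^ 2 + 1)⁻¹ - δ) 0 with ⟨e, h1⟩ | ⟨e, h1⟩ <;> rw [e] <;>
      constructor <;> linarith
  have heq : funcCc A (fun x => decay x + -1 * φ x) y = funcCc A decay y := by
    rw [← funcCc_add hA isDecaying_decay hneg, ← funcCc_const_mul hA hdφ, add_apply, smul_apply,
      h φ hcont hcpt, smul_zero, add_zero]
  rw [← heq, zero_add]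
  exact (ContinuousLinearMap.le_opNorm _ _).trans
    ((mul_le_mul_of_nonneg_right hle (norm_nonneg _)).trans hδε)

/-! ### Products with unbounded operators, and the identification of `f(A)` for bounded `f` -/

theorem IsProd.prodCLM_eq {E F D : Type*} [NormedAddCommGroup E] [InnerProductSpace ℂ E]
    [NormedAddCommGroup F] [InnerProductSpace ℂ F] [NormedAddCommGroup D] [InnerProductSpace ℂ D]
    {T : E →ₗ.[ℂ] F} {B : D →L[ℂ] E} {C : D →L[ℂ] F} (h : IsProd T B C) : prodCLM T B = C := by
  have hex : ∃ C, IsProd T B C := ⟨C, h⟩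
  rw [prodCLM, dif_pos hex]
  ext x
  obtain ⟨_, h1⟩ := hex.choose_spec x
  obtain ⟨_, h2⟩ := h x
  rw [← h1, ← h2]

theorem IsProd.comp {E F D D' : Type*} [NormedAddCommGroup E] [InnerProductSpace ℂ E]
    [NormedAddCommGroup F] [InnerProductSpace ℂ F] [NormedAddCommGroup D] [InnerProductSpace ℂ D]
    [NormedAddCommGroup D'] [InnerProductSpace ℂ D']
    {T : E →ₗ.[ℂ] F} {B : D →L[ℂ] E} {C : D →L[ℂ] F} (h : IsProd T B C) (B' : D' →L[ℂ] D) :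
    IsProd T (B ∘L B') (C ∘L B') := fun x => h (B' x)

theorem funcB_eq_bddFunc {A : H →ₗ.[ℂ] H} (hA : IsSelfAdjoint A) {f : ℝ → ℂ} (hf : IsBddCont f) :
    funcB A f = bddFunc A f := by
  refine IsProd.prodCLM_eq fun x => ?_
  -- Single-valuedness is needed because `toLinearPMap` recovers a submodule as its graph only under
  -- this condition.
  have hgraph : ∀ p ∈ funcGraph A f, p.1 = 0 → p.2 = 0 := by
    intro p hp h0
    refine eq_zero_of_funcCc_eq_zero hA fun φ h1 h2 => ?_
    rw [hp φ h1 h2, h0, map_zero]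
  have hmem : (x, bddFunc A f x) ∈ funcGraph A f := by
    intro φ h1 h2
    rw [← funcCc_mul_bddFunc hA hf (isDecaying_of_hasCompactSupport h1 h2)]
    rfl
  rw [← Submodule.toLinearPMap_graph_eq _ hgraph, LinearPMap.mem_graph_iff] at hmem
  obtain ⟨y, hy1, hy2⟩ := hmem
  have hx : (1 : H →L[ℂ] H) x = y := by rw [hy1]; rfl
  have hm : (1 : H →L[ℂ] H) x ∈ (func A f).domain := hx ▸ y.2
  have hxy : (⟨_, hm⟩ : (func A f).domain) = y := Subtype.ext hx
  exact ⟨hm, (congrArg (func A f) hxy).trans hy2⟩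

theorem invSqrtAbsAddOne_eq {A : H →ₗ.[ℂ] H} (hA : IsSelfAdjoint A) :
    invSqrtAbsAddOne A = bddFunc A invSqrtFun :=
  funcB_eq_bddFunc hA isBddCont_invSqrtFun

end calculus

/-! ### The operator `H(H₀, G, J)` -/

section perturbation

/-- The algebra behind Krein's formula: telescope `ΓXΛ - Γ'X'Λ'` as `ΓX(Λ - Λ') + Γ(X - X')Λ' + (Γ -
Γ')X'Λ'`. Together with `R - R'`, the four differences produce exactly the four terms of the product
on the right. -/
theorem krein_sub_eq {H K : Type*} [NormedAddCommGroup H] [InnerProductSpace ℂ H]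
    [NormedAddCommGroup K] [InnerProductSpace ℂ K] {R R' : H →L[ℂ] H} {Λ Λ' : H →L[ℂ] K} {Γ Γ' : K →L[ℂ] H} {X X' : K →L[ℂ] K}
    {c : ℂ} (hR : R - R' = c • (R * R')) (hΛ : Λ - Λ' = c • (Λ ∘L R'))
    (hΓ : Γ - Γ' = c • (R ∘L Γ')) (hX : X - X' = -(c • (X ∘L (Λ ∘L Γ') ∘L X'))) :
    (R - Γ ∘L X ∘L Λ) - (R' - Γ' ∘L X' ∘L Λ') =
      c • ((R - Γ ∘L X ∘L Λ) * (R' - Γ' ∘L X' ∘L Λ')) := by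
  ext x
  have h1 := congrArg (fun T => T x) hR
  have h2 := congrArg (fun T => Γ (X (T x))) hΛ
  have h3 := congrArg (fun T => T (X' (Λ' x))) hΓ
  have h4 := congrArg (fun T => Γ (T (Λ' x))) hX
  simp only [sub_apply, smul_apply, mul_apply_eq_comp, ContinuousLinearMap.comp_apply, map_sub,
    map_smul, neg_apply, map_neg] at h1 h2 h3 h4 ⊢
  linear_combination (norm := module) h1 - h2 - h3 - h4

variable {H K : Type*} [NormedAddCommGroup H] [InnerProductSpace ℂ H] [CompleteSpace H]
  [NormedAddCommGroup K] [InnerProductSpace ℂ K] [CompleteSpace K]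

/-- The function `(|x| + 1)^{1/2} / (x - z)`. -/
def sqrtDivFun (z : ℂ) (x : ℝ) : ℂ := (((|x| : ℝ) : ℂ) + 1) / ((x : ℂ) - z) * invSqrtFun x

theorem isBddCont_sqrtDivFun {z : ℂ} (hz : z.im ≠ 0) : IsBddCont (sqrtDivFun z) :=
  (isBddCont_abs_add_one_div hz).mul isBddCont_invSqrtFun

theorem star_sqrtDivFun (z : ℂ) (x : ℝ) :
    star (sqrtDivFun z x) = sqrtDivFun (starRingEnd ℂ z) x := by
  simp only [sqrtDivFun, star_mul', star_invSqrtFun, Complex.star_def, map_div₀, map_add, map_sub,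
    map_one, Complex.conj_ofReal]

/-- The operator `G (H₀ - z)⁻¹`. -/
def opGRes (H₀ : H →ₗ.[ℂ] H) (G : H →ₗ.[ℂ] K) (z : ℂ) : H →L[ℂ] K :=
  prodCLM G (invSqrtAbsAddOne H₀) ∘L bddFunc H₀ (sqrtDivFun z)

/-- The operator `(G (H₀ - z̄)⁻¹)*`. -/
def opResG (H₀ : H →ₗ.[ℂ] H) (G : H →ₗ.[ℂ] K) (z : ℂ) : K →L[ℂ] H :=
  bddFunc H₀ (sqrtDivFun z) ∘L ContinuousLinearMap.adjoint (prodCLM G (invSqrtAbsAddOne H₀))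

variable {H₀ : H →ₗ.[ℂ] H} {G : H →ₗ.[ℂ] K} {J : K →L[ℂ] K}

theorem adjoint_opGRes (hH : IsSelfAdjoint H₀) (G : H →ₗ.[ℂ] K) {z : ℂ} (hz : z.im ≠ 0) :
    ContinuousLinearMap.adjoint (opGRes H₀ G (starRingEnd ℂ z)) = opResG H₀ G z := by
  rw [opGRes, opResG, ContinuousLinearMap.adjoint_comp, ← ContinuousLinearMap.star_eq_adjoint
    (bddFunc H₀ _), star_bddFunc hH (isBddCont_sqrtDivFun (conj_im_ne_zero hz))]
  simp only [star_sqrtDivFun, Complex.conj_conj]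

theorem invSqrt_mul_sqrtDiv (hH : IsSelfAdjoint H₀) {z : ℂ} (hz : z.im ≠ 0) :
    bddFunc H₀ invSqrtFun * bddFunc H₀ (sqrtDivFun z) = res H₀ z := by
  rw [bddFunc_mul hH isBddCont_invSqrtFun (isBddCont_sqrtDivFun hz), res_eq_bddFunc hH hz]
  congr 1
  ext x
  rw [sqrtDivFun, div_eq_mul_inv]
  linear_combination ((x : ℂ) - z)⁻¹ * invSqrtFun_sq x

theorem sqrtDiv_mul_invSqrt (hH : IsSelfAdjoint H₀) {z : ℂ} (hz : z.im ≠ 0) :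
    bddFunc H₀ (sqrtDivFun z) * bddFunc H₀ invSqrtFun = res H₀ z := by
  rw [← invSqrt_mul_sqrtDiv hH hz, bddFunc_mul hH isBddCont_invSqrtFun (isBddCont_sqrtDivFun hz),
    bddFunc_mul hH (isBddCont_sqrtDivFun hz) isBddCont_invSqrtFun]
  simp only [mul_comm]

theorem eq_zero_of_sqrtDiv (hH : IsSelfAdjoint H₀) {z : ℂ} (hz : z.im ≠ 0) {x : H}
    (hx : bddFunc H₀ (sqrtDivFun z) x = 0) : x = 0 := by
  refine (hH.isResolventAt_res hz).eq_zero ?_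
  rw [← invSqrt_mul_sqrtDiv hH hz, mul_apply_eq_comp, hx, map_zero]

theorem sqrtDiv_sub (hH : IsSelfAdjoint H₀) {z w : ℂ} (hz : z.im ≠ 0) (hw : w.im ≠ 0) :
    bddFunc H₀ (sqrtDivFun z) - bddFunc H₀ (sqrtDivFun w) =
      (z - w) • (bddFunc H₀ (sqrtDivFun z) * res H₀ w) := by
  have h1 := isBddCont_sqrtDivFun hz
  have h2 := isBddCont_inv_sub hw
  rw [sub_eq_iff_eq_add, res_eq_bddFunc hH hw, bddFunc_mul hH h1 h2,
    bddFunc_const_mul hH (h1.mul h2),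
    bddFunc_add hH ((isBddCont_const _).mul (h1.mul h2)) (isBddCont_sqrtDivFun hw)]
  congr 1
  ext x
  have := ofReal_sub_ne_zero hz x
  have := ofReal_sub_ne_zero hw x
  simp only [sqrtDivFun]
  field_simp
  ring

theorem opGRes_sub (hH : IsSelfAdjoint H₀) (G : H →ₗ.[ℂ] K) {z w : ℂ} (hz : z.im ≠ 0)
    (hw : w.im ≠ 0) : opGRes H₀ G z - opGRes H₀ G w = (z - w) • (opGRes H₀ G z ∘L res H₀ w) := by
  simp only [opGRes]
  rw [← ContinuousLinearMap.comp_sub, sqrtDiv_sub hH hz hw, ContinuousLinearMap.comp_smul]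
  rfl

theorem opResG_sub (hH : IsSelfAdjoint H₀) (G : H →ₗ.[ℂ] K) {z w : ℂ} (hz : z.im ≠ 0)
    (hw : w.im ≠ 0) : opResG H₀ G z - opResG H₀ G w = (z - w) • (res H₀ z ∘L opResG H₀ G w) := by
  have h := sqrtDiv_sub hH hw hz
  have h1 : bddFunc H₀ (sqrtDivFun w) * res H₀ z = res H₀ z * bddFunc H₀ (sqrtDivFun w) := by
    rw [res_eq_bddFunc hH hz, bddFunc_mul hH (isBddCont_sqrtDivFun hw) (isBddCont_inv_sub hz),
      bddFunc_mul hH (isBddCont_inv_sub hz) (isBddCont_sqrtDivFun hw)]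
    simp only [mul_comm]
  simp only [opResG]
  rw [← ContinuousLinearMap.sub_comp, ← neg_sub, h, h1, ← neg_smul, neg_sub,
    ContinuousLinearMap.smul_comp]
  rfl

theorem opT_eq (hH : IsSelfAdjoint H₀) (G : H →ₗ.[ℂ] K) {z : ℂ} (hz : z.im ≠ 0) :
    opT H₀ G z = prodCLM G (invSqrtAbsAddOne H₀) ∘L
      bddFunc H₀ (fun x => (((|x| : ℝ) : ℂ) + 1) / ((x : ℂ) - z)) ∘L
        ContinuousLinearMap.adjoint (prodCLM G (invSqrtAbsAddOne H₀)) := by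
  rw [opT, funcB_eq_bddFunc hH (isBddCont_abs_add_one_div hz)]

/-- Pointwise, `(|x| + 1)((x - z)⁻¹ - (x - w)⁻¹)` is `z - w` times the product of the two functions
`sqrtDivFun`. This supplies the resolvent identity for the perturbed operator and, with `w = z̄`,
the sign of `Im T(z)`. -/
theorem opT_sub (hH : IsSelfAdjoint H₀) (G : H →ₗ.[ℂ] K) {z w : ℂ} (hz : z.im ≠ 0)
    (hw : w.im ≠ 0) :
    opT H₀ G z - opT H₀ G w = (z - w) • (opGRes H₀ G z ∘L opResG H₀ G w) := by
  have h1 := isBddCont_sqrtDivFun hz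
  have h2 := isBddCont_sqrtDivFun hw
  have h3 := isBddCont_abs_add_one_div hw
  have h : bddFunc H₀ (fun x => (((|x| : ℝ) : ℂ) + 1) / ((x : ℂ) - z)) =
      (z - w) • (bddFunc H₀ (sqrtDivFun z) * bddFunc H₀ (sqrtDivFun w)) +
        bddFunc H₀ (fun x => (((|x| : ℝ) : ℂ) + 1) / ((x : ℂ) - w)) := by
    rw [bddFunc_mul hH h1 h2, bddFunc_const_mul hH (h1.mul h2),
      bddFunc_add hH ((isBddCont_const _).mul (h1.mul h2)) h3]
    congr 1
    ext x
    have e := invSqrtFun_sq x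
    have := ofReal_sub_ne_zero hz x
    have := ofReal_sub_ne_zero hw x
    simp only [sqrtDivFun]
    field_simp
    linear_combination -(((|x| : ℝ) : ℂ) + 1) * (z - w) * e
  rw [opT_eq hH G hz, opT_eq hH G hw, h, opGRes, opResG]
  ext x
  simp only [sub_apply, ContinuousLinearMap.comp_apply, add_apply, smul_apply, mul_apply_eq_comp,
    map_add, map_smul, add_sub_cancel_right]

theorem star_opT (hH : IsSelfAdjoint H₀) (G : H →ₗ.[ℂ] K) {z : ℂ} (hz : z.im ≠ 0) :
    star (opT H₀ G z) = opT H₀ G (starRingEnd ℂ z) := by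
  rw [opT_eq hH G hz, opT_eq hH G (conj_im_ne_zero hz), ContinuousLinearMap.star_eq_adjoint,
    ContinuousLinearMap.adjoint_comp, ContinuousLinearMap.adjoint_comp,
    ContinuousLinearMap.adjoint_adjoint, ← ContinuousLinearMap.star_eq_adjoint (bddFunc H₀ _),
    star_bddFunc hH (isBddCont_abs_add_one_div hz), ContinuousLinearMap.comp_assoc]
  simp only [Complex.star_def, map_div₀, map_add, map_sub, map_one, Complex.conj_ofReal]

theorem Assumptions.isProd (hA : Assumptions H₀ G J) :
    IsProd G (bddFunc H₀ invSqrtFun) (prodCLM G (invSqrtAbsAddOne H₀)) := by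
  obtain ⟨C, hC, -⟩ := hA.compact
  rw [hC.prodCLM_eq, ← invSqrtAbsAddOne_eq hA.selfAdjoint]
  exact hC

/-- The resolvent factors through `(|H₀| + I)^{-1/2}`, on whose range `G` is defined. -/
theorem Assumptions.prodCLM_res (hA : Assumptions H₀ G J) {z : ℂ} (hz : z.im ≠ 0) :
    prodCLM G (res H₀ z) = opGRes H₀ G z := by
  have h := hA.isProd.comp (bddFunc H₀ (sqrtDivFun z))
  rw [← ContinuousLinearMap.mul_def, invSqrt_mul_sqrtDiv hA.selfAdjoint hz] at h
  exact h.prodCLM_eq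

theorem Assumptions.isCompactOperator_comp (hA : Assumptions H₀ G J) {E : Type*}
    [NormedAddCommGroup E] [NormedSpace ℂ E] (B : E →L[ℂ] H) :
    IsCompactOperator (prodCLM G (invSqrtAbsAddOne H₀) ∘L B) := by
  obtain ⟨C, hC, hc⟩ := hA.compact
  rw [hC.prodCLM_eq]
  exact hc.comp_clm B

/-! ### Invertibility of `I + J T(z)` and of `J⁻¹ + T(z)` -/

theorem Assumptions.isUnit_J (hA : Assumptions H₀ G J) : IsUnit J := by
  have h := hA.zero_mem_J
  rwa [spectrum.mem_resolventSet_iff, map_zero, zero_sub, IsUnit.neg_iff] at h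

theorem Assumptions.inverse_J_self (hA : Assumptions H₀ G J) : IsSelfAdjoint (Ring.inverse J) := by
  rw [isSelfAdjoint_iff, ← Ring.inverse_star, hA.selfAdjoint_J.star_eq]

/-- Since `sqrtDivFun w` of `H₀` is injective, `u` is already killed by `(G (|H₀| + I)^{-1/2})*`,
the rightmost factor of `T(z)`. -/
theorem opT_apply_eq_zero (hH : IsSelfAdjoint H₀) {z w : ℂ} (hz : z.im ≠ 0) (hw : w.im ≠ 0)
    {u : K} (hu : opResG H₀ G w u = 0) : opT H₀ G z u = 0 := by
  have h : ContinuousLinearMap.adjoint (prodCLM G (invSqrtAbsAddOne H₀)) u = 0 :=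
    eq_zero_of_sqrtDiv hH hw hu
  rw [opT_eq hH G hz, ContinuousLinearMap.comp_apply, ContinuousLinearMap.comp_apply, h, map_zero,
    map_zero]

/-- `J T(z)` is compact, so it is enough to exclude the eigenvalue `-1`. If `J T u = -u`, then `T u
= -J⁻¹u` and `(u, Tu)` is real because `J⁻¹` is self-adjoint. But `Im (u, Tu)` is `Im z` times a
squared norm, whose vanishing forces `T u = 0` and then `u = 0`. -/
theorem Assumptions.isUnit_one_add (hA : Assumptions H₀ G J) {z : ℂ} (hz : z.im ≠ 0) :
    IsUnit (1 + J * opT H₀ G z) := by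
  have hH := hA.selfAdjoint
  have hc : IsCompactOperator (J * opT H₀ G z : K →L[ℂ] K) :=
    (hA.isCompactOperator_comp _).clm_comp J
  by_contra hnot
  have hspec : (-1 : ℂ) ∈ spectrum ℂ (J * opT H₀ G z) := by
    rw [spectrum.mem_iff]
    intro h
    apply hnot
    rw [← IsUnit.neg_iff] at h
    convert h using 1
    simp [add_comm]
  obtain ⟨u, hu⟩ := ((hc.hasEigenvalue_iff_mem_spectrum (by simp)).2 hspec).exists_hasEigenvector
  have hu0 : u ≠ 0 := hu.2
  have hJT : J (opT H₀ G z u) = -u := by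
    have := hu.apply_eq_smul
    simpa using this
  have hT : opT H₀ G z u = -Ring.inverse J u := by
    have h1 : Ring.inverse J (J (opT H₀ G z u)) = Ring.inverse J (-u) := by rw [hJT]
    rwa [← mul_apply_eq_comp (Ring.inverse J) J, Ring.inverse_mul_cancel _ hA.isUnit_J,
      one_apply_eq_self, map_neg] at h1
  have hreal : inner ℂ u ((opT H₀ G z - star (opT H₀ G z)) u) = 0 := by
    have h1 : inner ℂ (Ring.inverse J u) u = inner ℂ u (Ring.inverse J u) := by
      nth_rewrite 1 [← hA.inverse_J_self.star_eq]
      rw [ContinuousLinearMap.star_eq_adjoint, ContinuousLinearMap.adjoint_inner_left]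
    rw [sub_apply, inner_sub_right, ContinuousLinearMap.star_eq_adjoint,
      ContinuousLinearMap.adjoint_inner_right, hT, inner_neg_left, inner_neg_right, h1, sub_self]
  have hz' := conj_im_ne_zero hz
  have hG : opResG H₀ G (starRingEnd ℂ z) u = 0 := by
    have hne : z - starRingEnd ℂ z ≠ 0 := by
      rw [Complex.sub_conj]
      simpa using hz
    have hadj : opGRes H₀ G z = ContinuousLinearMap.adjoint (opResG H₀ G (starRingEnd ℂ z)) := by
      rw [← adjoint_opGRes hH G hz', ContinuousLinearMap.adjoint_adjoint, Complex.conj_conj]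
    rw [star_opT hH G hz, opT_sub hH G hz hz', smul_apply, inner_smul_right,
      ContinuousLinearMap.comp_apply, hadj, ContinuousLinearMap.adjoint_inner_right] at hreal
    exact inner_self_eq_zero.1 ((mul_eq_zero.1 hreal).resolve_left hne)
  have h0 := opT_apply_eq_zero hH hz hz' hG
  rw [h0, map_zero] at hJT
  exact hu0 (neg_eq_zero.1 hJT.symm)

theorem Assumptions.inverse_J_add (hA : Assumptions H₀ G J) (T : K →L[ℂ] K) :
    Ring.inverse J + T = Ring.inverse J * (1 + J * T) := by
  rw [mul_add, mul_one, Ring.inverse_mul_cancel_left _ _ hA.isUnit_J]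

theorem Assumptions.isUnit_inverse_J_add (hA : Assumptions H₀ G J) {z : ℂ} (hz : z.im ≠ 0) :
    IsUnit (Ring.inverse J + opT H₀ G z) := by
  rw [hA.inverse_J_add]
  exact hA.isUnit_J.ringInverse.mul (hA.isUnit_one_add hz)

/-- Passes from the form `(I + JT)⁻¹J` in the definition of `H` to `(J⁻¹ + T)⁻¹`, whose adjoint at
`z` is its value at `z̄`. -/
theorem Assumptions.inverse_one_add_mul (hA : Assumptions H₀ G J) (T : K →L[ℂ] K) :
    Ring.inverse (1 + J * T) * J = Ring.inverse (Ring.inverse J + T) := by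
  rw [hA.inverse_J_add, Ring.inverse_mul (Or.inl hA.isUnit_J.ringInverse),
    Ring.inverse_inverse hA.isUnit_J]

theorem inverse_sub_inverse {B : Type*} [Ring B] {a b : B} (ha : IsUnit a) (hb : IsUnit b) :
    Ring.inverse a - Ring.inverse b = Ring.inverse a * (b - a) * Ring.inverse b := by
  rw [mul_sub, sub_mul, Ring.inverse_mul_cancel _ ha, mul_assoc, Ring.mul_inverse_cancel _ hb,
    mul_one, one_mul]

/-- The resolvent of `H(H₀, G, J)`. -/
def perturbedRes (H₀ : H →ₗ.[ℂ] H) (G : H →ₗ.[ℂ] K) (J : K →L[ℂ] K) (z : ℂ) : H →L[ℂ] H :=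
  res H₀ z - opResG H₀ G z ∘L Ring.inverse (Ring.inverse J + opT H₀ G z) ∘L opGRes H₀ G z

theorem Assumptions.perturbedRes_sub (hA : Assumptions H₀ G J) {z w : ℂ} (hz : z.im ≠ 0)
    (hw : w.im ≠ 0) : perturbedRes H₀ G J z - perturbedRes H₀ G J w =
      (z - w) • (perturbedRes H₀ G J z * perturbedRes H₀ G J w) := by
  have hH := hA.selfAdjoint
  refine krein_sub_eq ((hH.isResolventAt_res hz).sub_eq (hH.isResolventAt_res hw))
    (opGRes_sub hH G hz hw) (opResG_sub hH G hz hw) ?_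
  rw [inverse_sub_inverse (hA.isUnit_inverse_J_add hz) (hA.isUnit_inverse_J_add hw),
    add_sub_add_left_eq_sub, ← neg_sub, opT_sub hH G hz hw, mul_neg, neg_mul, mul_smul_comm,
    smul_mul_assoc]
  rfl

theorem Assumptions.star_inverse_J_add (hA : Assumptions H₀ G J) {z : ℂ} (hz : z.im ≠ 0) :
    star (Ring.inverse (Ring.inverse J + opT H₀ G z)) =
      Ring.inverse (Ring.inverse J + opT H₀ G (starRingEnd ℂ z)) := by
  rw [← Ring.inverse_star, star_add, hA.inverse_J_self.star_eq, star_opT hA.selfAdjoint G hz]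

theorem Assumptions.star_perturbedRes (hA : Assumptions H₀ G J) {z : ℂ} (hz : z.im ≠ 0) :
    star (perturbedRes H₀ G J z) = perturbedRes H₀ G J (starRingEnd ℂ z) := by
  have hH := hA.selfAdjoint
  have h1 := adjoint_opGRes hH G (conj_im_ne_zero hz)
  have h2 := adjoint_opGRes hH G hz
  rw [Complex.conj_conj] at h1
  rw [perturbedRes, perturbedRes, star_sub, star_res hH hz, ContinuousLinearMap.star_eq_adjoint,
    ContinuousLinearMap.adjoint_comp, ContinuousLinearMap.adjoint_comp, h1, ← h2,
    ContinuousLinearMap.adjoint_adjoint, ← ContinuousLinearMap.star_eq_adjoint,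
    hA.star_inverse_J_add hz, ContinuousLinearMap.comp_assoc]

/-- With `v = (J⁻¹ + T(z))⁻¹ G R₀(z) x` the hypothesis reads `R₀(z)x = (G R₀(z̄))* v`. Cancelling
the injective factor common to both sides leaves `(|H₀| + I)^{-1/2} x = (G (|H₀| + I)^{-1/2})* v`,
hence `G R₀(z)x = T(z)v`. The definition of `v` makes the same vector `(J⁻¹ + T(z))v`, so `J⁻¹v =
0`. -/
theorem Assumptions.perturbedRes_injective (hA : Assumptions H₀ G J) {z : ℂ} (hz : z.im ≠ 0)
    (x : H) (hx : perturbedRes H₀ G J z x = 0) : x = 0 := by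
  have hH := hA.selfAdjoint
  set v := Ring.inverse (Ring.inverse J + opT H₀ G z) (opGRes H₀ G z x) with hv
  have h1 : res H₀ z x = opResG H₀ G z v := by
    rw [perturbedRes, sub_apply] at hx
    exact sub_eq_zero.1 hx
  have h2 : bddFunc H₀ invSqrtFun x =
      ContinuousLinearMap.adjoint (prodCLM G (invSqrtAbsAddOne H₀)) v := by
    rw [← sub_eq_zero]
    refine eq_zero_of_sqrtDiv hH hz ?_
    rw [map_sub, ← mul_apply_eq_comp, sqrtDiv_mul_invSqrt hH hz, h1, opResG,
      ContinuousLinearMap.comp_apply, sub_self]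
  have h3 : opGRes H₀ G z x = opT H₀ G z v := by
    rw [opT_eq hH G hz, ContinuousLinearMap.comp_apply, ContinuousLinearMap.comp_apply, ← h2,
      ← mul_apply_eq_comp, bddFunc_mul hH (isBddCont_abs_add_one_div hz) isBddCont_invSqrtFun]
    rfl
  have h4 : (Ring.inverse J + opT H₀ G z) v = opT H₀ G z v := by
    rw [← h3, hv, ← mul_apply_eq_comp, Ring.mul_inverse_cancel _ (hA.isUnit_inverse_J_add hz),
      one_apply_eq_self]
  have h5 : v = 0 := by
    rw [add_apply, add_eq_right] at h4
    have h6 := congrArg J h4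
    rwa [← mul_apply_eq_comp, Ring.mul_inverse_cancel _ hA.isUnit_J, one_apply_eq_self,
      map_zero] at h6
  rw [h5, map_zero] at h1
  exact (hH.isResolventAt_res hz).eq_zero h1

theorem Assumptions.exists_isPerturbed (hA : Assumptions H₀ G J) :
    ∃ H₁, IsPerturbed H₀ G J H₁ := by
  have hH := hA.selfAdjoint
  obtain ⟨A, h1, h2⟩ := exists_isSelfAdjoint_of_pseudoResolvent (perturbedRes H₀ G J)
    (fun z hz => hA.star_perturbedRes hz) (fun z w hz hw => hA.perturbedRes_sub hz hw)
    (fun z hz => hA.perturbedRes_injective hz)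
  refine ⟨A, h1, fun z hz => ?_⟩
  rw [(h2 z hz).res_eq, hA.prodCLM_res hz, hA.prodCLM_res (conj_im_ne_zero hz),
    adjoint_opGRes hH G hz, perturbedRes, ← hA.inverse_one_add_mul, sub_sub_cancel_left]
  rfl

theorem Assumptions.isPerturbed (hA : Assumptions H₀ G J) :
    IsPerturbed H₀ G J (perturbed H₀ G J) := by
  rw [perturbed, dif_pos hA.exists_isPerturbed]
  exact hA.exists_isPerturbed.choose_spec

/-- The defining formula fixes the resolvent whichever operator is chosen, so uniqueness of `H`
plays no role in the argument. -/
theorem Assumptions.res_perturbed (hA : Assumptions H₀ G J) {z : ℂ} (hz : z.im ≠ 0) :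
    res (perturbed H₀ G J) z = perturbedRes H₀ G J z := by
  have h := hA.isPerturbed.2 z hz
  rw [hA.prodCLM_res hz, hA.prodCLM_res (conj_im_ne_zero hz), adjoint_opGRes hA.selfAdjoint G hz,
    sub_eq_iff_eq_add] at h
  rw [h, perturbedRes, ← hA.inverse_one_add_mul, neg_add_eq_sub]
  rfl

/-- `M(z) - I = (z̄ - z) (G (H₀ - z̄)⁻¹)* (J⁻¹ + T(z))⁻¹ G (H₀ - z̄)⁻¹`. -/
theorem Assumptions.opM_eq (hA : Assumptions H₀ G J) {z : ℂ} (hz : z.im ≠ 0) :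
    opM (perturbed H₀ G J) H₀ z = 1 + opResG H₀ G z ∘L ((starRingEnd ℂ z - z) •
      (Ring.inverse (Ring.inverse J + opT H₀ G z) ∘L opGRes H₀ G (starRingEnd ℂ z))) := by
  have hH := hA.selfAdjoint
  have hz' := conj_im_ne_zero hz
  have h1 := one_add_res_mul hH hz hz'
  have h2 := opGRes_sub hH G hz hz'
  rw [opM, hA.res_perturbed hz, perturbedRes]
  ext x
  have h1 := congrArg (fun T => T x) h1
  have h2 := congrArg (fun T =>
    opResG H₀ G z (Ring.inverse (Ring.inverse J + opT H₀ G z) (T x))) h2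
  simp only [sub_apply, smul_apply, mul_apply_eq_comp, ContinuousLinearMap.comp_apply, map_sub,
    map_smul, add_apply, map_add, one_apply_eq_self] at h1 h2 ⊢
  -- The right factor `I + (z̄ - z)R₀(z̄)` of `M` inverts `I + (z - z̄)R₀(z)`, and it turns `G
  -- R₀(z)` into `G R₀(z̄)`.
  linear_combination (norm := module) h1 + (starRingEnd ℂ z - z) • h2

theorem Assumptions.isCompactOperator_opM_sub_one (hA : Assumptions H₀ G J) {z : ℂ}
    (hz : z.im ≠ 0) :
    IsCompactOperator (opM (perturbed H₀ G J) H₀ z - 1 : H →L[ℂ] H) := by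
  rw [hA.opM_eq hz, add_sub_cancel_left]
  have h : IsCompactOperator (opGRes H₀ G (starRingEnd ℂ z)) := hA.isCompactOperator_comp _
  exact (((h.clm_comp (Ring.inverse (Ring.inverse J + opT H₀ G z))).smul
    (starRingEnd ℂ z - z))).clm_comp (opResG H₀ G z)

theorem Assumptions.opM_mem_YInf (hA : Assumptions H₀ G J) {z : ℂ} (hz : z.im ≠ 0) :
    opM (perturbed H₀ G J) H₀ z ∈ YInf H := by
  refine ⟨?_, hA.isCompactOperator_opM_sub_one hz⟩
  have h := one_add_res_mem_unitary hA.selfAdjoint (conj_im_ne_zero hz)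
  rw [Complex.conj_conj] at h
  exact mul_mem (one_add_res_mem_unitary hA.isPerturbed.1 hz) h

end perturbation

/-! ### Ranks of spectral projections and eigenspaces -/

section eigenspaces

theorem finrank_biSup_of_iSupIndep {ι V : Type*} [AddCommGroup V] [Module ℂ V]
    {p : ι → Submodule ℂ V} (hp : iSupIndep p) (s : Finset ι)
    (hfin : ∀ i ∈ s, FiniteDimensional ℂ (p i)) :
    Module.finrank ℂ (⨆ i ∈ s, p i : Submodule ℂ V) = ∑ i ∈ s, Module.finrank ℂ (p i) := by
  classical
  induction s using Finset.induction_on with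
  | empty =>
    have h : (⨆ i ∈ (∅ : Finset ι), p i) = ⊥ := by simp
    rw [h, finrank_bot, Finset.sum_empty]
  | insert a s ha ih =>
    have h1 : FiniteDimensional ℂ (p a) := hfin a (Finset.mem_insert_self a s)
    have h2 : FiniteDimensional ℂ (⨆ i ∈ s, p i : Submodule ℂ V) := by
      rw [iSup_subtype' (p := fun i => i ∈ s)]
      have : ∀ i : {i // i ∈ s}, FiniteDimensional ℂ (p i) :=
        fun i => hfin i (Finset.mem_insert_of_mem i.2)
      infer_instance
    have h3 : Disjoint (p a) (⨆ i ∈ s, p i) :=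
      (hp a).mono_right (iSup₂_le fun i hi =>
        le_iSup₂_of_le i (ne_of_mem_of_not_mem hi ha) le_rfl)
    have h4 := Submodule.finrank_sup_add_finrank_inf_eq (p a) (⨆ i ∈ s, p i)
    rw [h3.eq_bot, finrank_bot, add_zero] at h4
    rw [Finset.iSup_insert, h4, Finset.sum_insert ha,
      ih fun i hi => hfin i (Finset.mem_insert_of_mem hi)]

/-- `Q` maps one eigenspace to the other and `c⁻¹P` is the inverse map; this is where `c ≠ 0`
enters. -/
theorem finrank_eigenspace_comp_comm {V V' : Type*} [AddCommGroup V] [Module ℂ V] [AddCommGroup V']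
    [Module ℂ V'] (P : V' →ₗ[ℂ] V) (Q : V →ₗ[ℂ] V') {c : ℂ} (hc : c ≠ 0) :
    Module.finrank ℂ (Module.End.eigenspace (P ∘ₗ Q) c) =
      Module.finrank ℂ (Module.End.eigenspace (Q ∘ₗ P) c) := by
  have hQ : ∀ x ∈ Module.End.eigenspace (P ∘ₗ Q) c, Q x ∈ Module.End.eigenspace (Q ∘ₗ P) c := by
    intro x hx
    rw [Module.End.mem_eigenspace_iff] at hx ⊢
    rw [LinearMap.comp_apply] at hx
    rw [LinearMap.comp_apply, hx, map_smul]
  have hP : ∀ x ∈ Module.End.eigenspace (Q ∘ₗ P) c,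
      (c⁻¹ • P) x ∈ Module.End.eigenspace (P ∘ₗ Q) c := by
    intro x hx
    rw [Module.End.mem_eigenspace_iff] at hx ⊢
    rw [LinearMap.comp_apply] at hx
    rw [LinearMap.comp_apply, LinearMap.smul_apply, map_smul, hx, map_smul, map_smul, smul_comm]
  refine LinearEquiv.finrank_eq (LinearEquiv.ofLinearMap (Q.restrict hQ) ((c⁻¹ • P).restrict hP) ?_ ?_)
  · ext ⟨x, hx⟩
    have h := Module.End.mem_eigenspace_iff.1 hx
    rw [LinearMap.comp_apply] at h
    simp [LinearMap.restrict_apply, h, smul_smul, hc]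
  · ext ⟨x, hx⟩
    have h := Module.End.mem_eigenspace_iff.1 hx
    rw [LinearMap.comp_apply] at h
    simp [LinearMap.restrict_apply, h, smul_smul, hc]

theorem eigenspace_one_add {V : Type*} [AddCommGroup V] [Module ℂ V] (T : Module.End ℂ V) (u : ℂ) :
    Module.End.eigenspace (1 + T) u = Module.End.eigenspace T (u - 1) := by
  ext x
  rw [Module.End.mem_eigenspace_iff, Module.End.mem_eigenspace_iff, LinearMap.add_apply,
    Module.End.one_apply, sub_smul, one_smul, eq_sub_iff_add_eq']

/-! ### Spectral projections of operators in `Y_∞` -/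

variable {E : Type*} [NormedAddCommGroup E] [InnerProductSpace ℂ E] [CompleteSpace E]

theorem continuousOn_indicator_singleton {W : E →L[ℂ] E} (hW : W ∈ YInf E) {u : ℂ} (hu : u ≠ 1) :
    ContinuousOn (({u} : Set ℂ).indicator (1 : ℂ → ℂ)) (spectrum ℂ W) := by
  refine continuousOn_of_zero_near_one hW (norm_pos_iff.2 (sub_ne_zero.2 hu)) fun v hv => ?_
  refine Set.indicator_of_notMem (fun h => ?_) _
  rw [Set.mem_singleton_iff.1 h] at hv
  exact lt_irrefl _ hv

/-- Let `χ` be the indicator of `{u}`. From `(w - u)χ = 0` the range lies in the eigenspace, and `1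
- χ = g(w)(w - u)` gives the converse. The quotient `g` is continuous on the spectrum because `u ≠
1` is not an accumulation point of it. -/
theorem range_specProj_singleton {W : E →L[ℂ] E} (hW : W ∈ YInf E) {u : ℂ} (hu : u ≠ 1) :
    LinearMap.range (specProj W {u} : E →ₗ[ℂ] E) =
      Module.End.eigenspace (W : E →ₗ[ℂ] E) u := by
  have := isStarNormal_of_mem hW
  have hc := continuousOn_indicator_singleton hW hu
  have hWu : W - u • 1 = cfc (fun w : ℂ => w - u) W := by
    rw [cfc_sub (fun w : ℂ => w) (fun _ => u) W, cfc_id' ℂ W, cfc_const u W,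
      Algebra.algebraMap_eq_smul_one]
  let g : ℂ → ℂ := fun w => (1 - ({u} : Set ℂ).indicator 1 w) / (w - u)
  have hg : ContinuousOn g (spectrum ℂ W) := by
    intro v hv
    by_cases hvu : v = u
    · subst hvu
      -- An indicator that moves by less than `1` does not move at all, so nearby spectral points
      -- coincide with `v`.
      have h1 := Metric.tendsto_nhds.1 (hc v hv).tendsto 1 one_pos
      refine (tendsto_const_nhds (x := g v)).congr' ?_
      filter_upwards [h1] with w hw
      by_cases h2 : w = v
      · rw [h2]
      · simp [h2] at hw
    · have h1 : ContinuousAt (fun w : ℂ => 1 / (w - u)) v :=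
        ContinuousAt.div (by fun_prop) (by fun_prop) (sub_ne_zero.2 hvu)
      refine (h1.congr ?_).continuousWithinAt
      filter_upwards [isOpen_ne.mem_nhds hvu] with w hw
      have : w ∉ ({u} : Set ℂ) := hw
      simp only [g]
      rw [Set.indicator_of_notMem this, sub_zero]
  have h1 : (W - u • 1) * specProj W {u} = 0 := by
    rw [hWu, specProj, ← cfc_mul _ _ W (by fun_prop) hc, ← cfc_const_zero ℂ W]
    congr 1
    ext w
    by_cases hw : w = u <;> simp [hw]
  have h2 : 1 - specProj W {u} = cfc g W * (W - u • 1) := by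
    rw [hWu, specProj, ← cfc_mul _ _ W hg (by fun_prop), ← cfc_const_one ℂ W,
      ← cfc_sub _ _ W (by fun_prop) hc]
    congr 1
    ext w
    by_cases hw : w = u
    · simp [hw]
    · have := sub_ne_zero.2 hw
      simp [g, hw, this]
  apply le_antisymm
  · rintro _ ⟨x, rfl⟩
    have h3 := congrArg (fun T : E →L[ℂ] E => T x) h1
    simp only [mul_apply_eq_comp, sub_apply, smul_apply, one_apply_eq_self, zero_apply] at h3
    exact Module.End.mem_eigenspace_iff.2 (sub_eq_zero.1 h3)
  · intro x hx
    have h4 : W x = u • x := Module.End.mem_eigenspace_iff.1 hx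
    have h3 := congrArg (fun T : E →L[ℂ] E => T x) h2
    simp only [mul_apply_eq_comp, sub_apply, smul_apply, one_apply_eq_self, h4, sub_self,
      map_zero] at h3
    exact ⟨x, (sub_eq_zero.1 h3).symm⟩

theorem ne_one_of_mem_arc {a b : ℝ} (ha : 0 < a) (hb : b < 2 * Real.pi) {u : ℂ}
    (hu : u ∈ arc a b) : u ≠ 1 := by
  rintro rfl
  obtain ⟨ε, hε, h⟩ := arc_far ha hb
  have := h hu
  rw [Set.mem_ofPred_eq, sub_self, norm_zero] at this
  exact not_lt.2 this hε

/-- On the spectrum the indicator of the arc is a finite sum of indicators of points, and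
eigenspaces are independent. `F` may contain points off the spectrum, so that two operators can be
compared over one common `F`. -/
theorem arcRank_eq_sum {W : E →L[ℂ] E} (hW : W ∈ YInf E) {a b : ℝ} (ha : 0 < a)
    (hb : b < 2 * Real.pi) {F : Finset ℂ} (hF : (F : Set ℂ) ⊆ arc a b)
    (hsp : arc a b ∩ spectrum ℂ W ⊆ F) :
    arcRank W a b = ∑ u ∈ F, Module.finrank ℂ (Module.End.eigenspace (W : E →ₗ[ℂ] E) u) := by
  have := isStarNormal_of_mem hW
  have hfin := finiteDimensional_range_specProj hW ha hb
  have hne : ∀ u ∈ F, u ≠ 1 := fun u hu => ne_one_of_mem_arc ha hb (hF hu)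
  have hcont : ∀ u ∈ F, ContinuousOn (({u} : Set ℂ).indicator (1 : ℂ → ℂ)) (spectrum ℂ W) :=
    fun u hu => continuousOn_indicator_singleton hW (hne u hu)
  have hsum : specProj W (arc a b) = ∑ u ∈ F, specProj W {u} := by
    simp only [specProj]
    rw [← cfc_sum _ W F hcont]
    refine cfc_congr fun w hw => ?_
    rw [Finset.sum_apply]
    by_cases h : w ∈ arc a b
    · have hwF : w ∈ F := hsp ⟨h, hw⟩
      rw [Finset.sum_eq_single w (fun v _ hv => ?_) (fun h' => absurd hwF h')]
      · simp [h]
      · exact Set.indicator_of_notMem (fun h' => hv (Set.mem_singleton_iff.1 h').symm) _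
    · rw [Set.indicator_of_notMem h, Finset.sum_eq_zero fun v hv => ?_]
      refine Set.indicator_of_notMem (fun h' => h ?_) _
      rw [Set.mem_singleton_iff.1 h']
      exact hF hv
  have hle : ∀ u ∈ F, Module.End.eigenspace (W : E →ₗ[ℂ] E) u ≤
      LinearMap.range (specProj W (arc a b) : E →ₗ[ℂ] E) := by
    intro u hu
    have hmul : specProj W (arc a b) * specProj W {u} = specProj W {u} := by
      simp only [specProj]
      rw [← cfc_mul _ _ W (continuousOn_indicator_arc hW ha hb) (hcont u hu)]
      congr 1
      ext w
      by_cases hw : w = u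
      · have : u ∈ arc a b := hF hu
        simp [hw, this]
      · simp [hw]
    rw [← range_specProj_singleton hW (hne u hu)]
    rintro _ ⟨x, rfl⟩
    exact ⟨specProj W {u} x, congrArg (fun T : E →L[ℂ] E => T x) hmul⟩
  have hrange : LinearMap.range (specProj W (arc a b) : E →ₗ[ℂ] E) =
      ⨆ u ∈ F, Module.End.eigenspace (W : E →ₗ[ℂ] E) u := by
    refine le_antisymm ?_ (iSup₂_le hle)
    rintro _ ⟨x, rfl⟩
    rw [hsum]
    simp only [ContinuousLinearMap.coe_coe, sum_apply]
    refine Submodule.sum_mem _ fun u hu => ?_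
    refine (le_iSup₂ (f := fun u (_ : u ∈ F) => Module.End.eigenspace (W : E →ₗ[ℂ] E) u) u hu) ?_
    rw [← range_specProj_singleton hW (hne u hu)]
    exact ⟨x, rfl⟩
  rw [arcRank, hrange]
  exact finrank_biSup_of_iSupIndep (Module.End.eigenspaces_iSupIndep _) F fun u hu =>
    Submodule.finiteDimensional_of_le (hle u hu)

variable {E' : Type*} [NormedAddCommGroup E'] [InnerProductSpace ℂ E'] [CompleteSpace E']

theorem arcRank_eq_of_eigenspaces {W : E →L[ℂ] E} (hW : W ∈ YInf E) {W' : E' →L[ℂ] E'}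
    (hW' : W' ∈ YInf E') (h : ∀ u : ℂ, u ≠ 1 →
      Module.finrank ℂ (Module.End.eigenspace (W : E →ₗ[ℂ] E) u) =
        Module.finrank ℂ (Module.End.eigenspace (W' : E' →ₗ[ℂ] E') u))
    {a b : ℝ} (ha : 0 < a) (hb : b < 2 * Real.pi) : arcRank W a b = arcRank W' a b := by
  obtain ⟨ε, hε, hfar⟩ := arc_far ha hb
  have hfin : (arc a b ∩ (spectrum ℂ W ∪ spectrum ℂ W')).Finite := by
    refine ((finite_spectrum hW hε).union (finite_spectrum hW' hε)).subset ?_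
    rintro u ⟨h1, h2 | h2⟩
    · exact Or.inl ⟨h2, hfar h1⟩
    · exact Or.inr ⟨h2, hfar h1⟩
  have hF : (hfin.toFinset : Set ℂ) ⊆ arc a b := by
    rw [hfin.coe_toFinset]
    exact Set.inter_subset_left
  rw [arcRank_eq_sum hW ha hb hF, arcRank_eq_sum hW' ha hb hF]
  · exact Finset.sum_congr rfl fun u hu => h u (ne_one_of_mem_arc ha hb (hF hu))
  · rw [hfin.coe_toFinset]
    exact Set.inter_subset_inter_right _ Set.subset_union_right
  · rw [hfin.coe_toFinset]
    exact Set.inter_subset_inter_right _ Set.subset_union_left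

/-- Both classes are represented with the same reference point `-1`, so the representatives
themselves agree and no integer constant appears. -/
theorem etaInf_eq_of_eigenspaces (W : YInf E) (W' : YInf E') (h : ∀ u : ℂ, u ≠ 1 →
      Module.finrank ℂ (Module.End.eigenspace (W.1 : E →ₗ[ℂ] E) u) =
        Module.finrank ℂ (Module.End.eigenspace (W'.1 : E' →ₗ[ℂ] E') u)) :
    etaInf W = etaInf W' := by
  refine congrArg (Quotient.mk XtInf.setoid) (Subtype.ext (funext fun θ => ?_))
  have key : ∀ a b : ℝ, 0 < a → b < 2 * Real.pi → arcRank W.1 a b = arcRank W'.1 a b :=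
    fun a b ha hb => arcRank_eq_of_eigenspaces W.2 W'.2 h ha hb
  have hpi : Real.pi < 2 * Real.pi := by linarith [Real.pi_pos]
  simp only [countFun, countN, key _ _ θ.2.1 hpi, key _ _ Real.pi_pos θ.2.2]

end eigenspaces

/-! ### The operator `S(z)` -/

section scattering

theorem cpow_half_of_nonneg {r : ℝ} (hr : 0 ≤ r) :
    ((r : ℂ)) ^ (1 / 2 : ℂ) = ((Real.sqrt r : ℝ) : ℂ) := by
  rw [Real.sqrt_eq_rpow, Complex.ofReal_cpow hr]
  norm_num

/-- The principal argument of a negative number is `π`, so the complex power takes the branch `i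
|x|^{1/2}`. -/
theorem cpow_half_of_nonpos {r : ℝ} (hr : 0 ≤ r) :
    (-(r : ℂ)) ^ (1 / 2 : ℂ) = I * ((Real.sqrt r : ℝ) : ℂ) := by
  have h : Complex.exp (Real.pi * I * (1 / 2)) = I := by
    have e : Real.pi * I * (1 / 2) = Real.pi / 2 * I := by ring
    rw [e, Complex.exp_pi_div_two_mul_I]
  rw [← Complex.ofReal_neg, Complex.ofReal_cpow_of_nonpos (by linarith), Complex.ofReal_neg,
    neg_neg, cpow_half_of_nonneg hr, h, mul_comm]

variable {K : Type*} [NormedAddCommGroup K] [InnerProductSpace ℂ K] [CompleteSpace K]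

theorem spectrum_of_nonneg {B : K →L[ℂ] K} (hB : 0 ≤ B) {w : ℂ} (hw : w ∈ spectrum ℂ B) :
    w = ((|w.re| : ℝ) : ℂ) := by
  have h1 := (IsSelfAdjoint.of_nonneg hB).mem_spectrum_eq_re hw
  have h2 : w.re ∈ spectrum ℝ B := by
    rw [← spectrum.algebraMap_mem_iff ℂ, Complex.coe_algebraMap]
    rwa [← h1]
  rw [abs_of_nonneg (spectrum_nonneg_of_nonneg hB h2), ← h1]

/-- `ζ` treats both signs at once: `ζ = 1` for `B ≥ 0` and `ζ = i` for `B ≤ 0`. The complex power,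
discontinuous across the negative axis, is replaced by a function continuous on the whole plane. -/
theorem opSqrt_eq_cfc {B : K →L[ℂ] K} {ζ : ℂ} (hζ : ζ = 1 ∨ ζ = I)
    (hsp : ∀ w ∈ spectrum ℂ B, w = ζ ^ 2 * ((|w.re| : ℝ) : ℂ)) :
    opSqrt B = cfc (fun w : ℂ => ζ * ((Real.sqrt |w.re| : ℝ) : ℂ)) B := by
  refine cfc_congr fun w hw => ?_
  have h := hsp w hw
  rcases hζ with rfl | rfl
  · rw [one_pow, one_mul] at h
    rw [one_mul, ← cpow_half_of_nonneg (abs_nonneg w.re), ← h]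
  · rw [Complex.I_sq, neg_one_mul] at h
    rw [← cpow_half_of_nonpos (abs_nonneg w.re), ← h]

theorem opSqrt_mul_self {B : K →L[ℂ] K} [IsStarNormal B] {ζ : ℂ} (hζ : ζ = 1 ∨ ζ = I)
    (hsp : ∀ w ∈ spectrum ℂ B, w = ζ ^ 2 * ((|w.re| : ℝ) : ℂ)) :
    opSqrt B * opSqrt B = B := by
  have hc : ContinuousOn (fun w : ℂ => ζ * ((Real.sqrt |w.re| : ℝ) : ℂ)) (spectrum ℂ B) :=
    Continuous.continuousOn (by fun_prop)
  rw [opSqrt_eq_cfc hζ hsp, ← cfc_mul _ _ B hc hc]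
  nth_rewrite 2 [← cfc_id' ℂ B]
  refine cfc_congr fun w hw => ?_
  nth_rewrite 3 [hsp w hw]
  have := Real.mul_self_sqrt (abs_nonneg w.re)
  rw [← this]
  push_cast
  simp only [this]
  ring

theorem star_opSqrt {B : K →L[ℂ] K} {ζ : ℂ} (hζ : ζ = 1 ∨ ζ = I)
    (hsp : ∀ w ∈ spectrum ℂ B, w = ζ ^ 2 * ((|w.re| : ℝ) : ℂ)) :
    star (opSqrt B) = opSqrt B ∨ star (opSqrt B) = -opSqrt B := by
  rw [opSqrt_eq_cfc hζ hsp, ← cfc_star, ← cfc_neg]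
  rcases hζ with rfl | rfl
  · left
    congr 1
    ext w
    simp
  · right
    congr 1
    ext w
    simp

theorem norm_sqrt_sub_le {r ε : ℝ} (hr : 0 ≤ r) (hε : 0 < ε) :
    |Real.sqrt r - r * (Real.sqrt r / (r + ε))| ≤ Real.sqrt ε := by
  have h0 : 0 < r + ε := by positivity
  have h1 : Real.sqrt r - r * (Real.sqrt r / (r + ε)) = Real.sqrt r * ε / (r + ε) := by
    field_simp
    ring
  have e1 := Real.sq_sqrt hr
  have e2 := Real.sq_sqrt hε.le
  have p1 := Real.sqrt_nonneg r
  have p2 := Real.sqrt_nonneg ε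
  rw [h1, abs_of_nonneg (by positivity), div_le_iff₀ h0]
  set a := Real.sqrt r
  set b := Real.sqrt ε
  rw [← e1, ← e2]
  -- The difference of the two sides is `b(a² + b²) - ab² = b((a - b)² + ab)`.
  nlinarith [mul_nonneg p2 (add_nonneg (sq_nonneg (a - b)) (mul_nonneg p1 p2))]

/-- `√r` is the uniform limit of `r · √r/(r + ε)`, so `B^{1/2}` is a norm limit of operators `B
g(B)`, which are compact. -/
theorem isCompactOperator_opSqrt {B : K →L[ℂ] K} [IsStarNormal B] (hB : IsCompactOperator B) {ζ : ℂ}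
    (hζ : ζ = 1 ∨ ζ = I) (hsp : ∀ w ∈ spectrum ℂ B, w = ζ ^ 2 * ((|w.re| : ℝ) : ℂ)) :
    IsCompactOperator (opSqrt B) := by
  have hζ1 : ‖ζ‖ = 1 := by rcases hζ with rfl | rfl <;> simp
  have hζ0 : ζ ≠ 0 := norm_ne_zero_iff.1 (by rw [hζ1]; exact one_ne_zero)
  rw [opSqrt_eq_cfc hζ hsp]
  set f : ℂ → ℂ := fun w => ζ * ((Real.sqrt |w.re| : ℝ) : ℂ)
  have hf : ContinuousOn f (spectrum ℂ B) := Continuous.continuousOn (by fun_prop)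
  have hcl : IsClosed {T : K →L[ℂ] K | IsCompactOperator T} := isClosed_setOfPred_isCompactOperator
  refine hcl.closure_subset (Metric.mem_closure_iff.2 fun δ hδ => ?_)
  -- The approximation error is at most `√ε`, here `δ/2`.
  set ε : ℝ := (δ / 2) ^ 2 with hεdef
  have hε : 0 < ε := by positivity
  let g : ℂ → ℂ := fun w => ζ⁻¹ * ((Real.sqrt |w.re| / (|w.re| + ε) : ℝ) : ℂ)
  have hg : ContinuousOn g (spectrum ℂ B) := by
    have h1 : Continuous fun w : ℂ => Real.sqrt |w.re| / (|w.re| + ε) :=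
      Continuous.div (by fun_prop) (by fun_prop) fun w => by positivity
    exact Continuous.continuousOn (by fun_prop)
  refine ⟨B * cfc g B, hB.comp_clm (cfc g B), ?_⟩
  have h1 : B * cfc g B = cfc (fun w => w * g w) B := by
    rw [cfc_mul (fun w : ℂ => w) g B (by fun_prop) hg, cfc_id' ℂ B]
  have hwg : ContinuousOn (fun w => w * g w) (spectrum ℂ B) := continuousOn_id.mul hg
  rw [dist_eq_norm, h1, ← cfc_sub _ _ B hf hwg]
  refine lt_of_le_of_lt (norm_cfc_le (c := δ / 2) (by positivity) fun w hw => ?_) (half_lt_self hδ)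
  have h2 : f w - w * g w = ζ * ((Real.sqrt |w.re| -
      |w.re| * (Real.sqrt |w.re| / (|w.re| + ε)) : ℝ) : ℂ) := by
    have h3 : w * g w = ζ ^ 2 * ((|w.re| : ℝ) : ℂ) * g w := by rw [← hsp w hw]
    rw [h3]
    simp only [f, g]
    push_cast
    field_simp
  rw [h2, norm_mul, hζ1, one_mul, Complex.norm_real, Real.norm_eq_abs]
  refine (norm_sqrt_sub_le (abs_nonneg _) hε).trans ?_
  rw [hεdef, Real.sqrt_sq (by positivity)]

/-- If `Q² = Im Y` and `Q* = ± Q`, then `I - 2i Q Y⁻¹ Q` is unitary. -/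
theorem one_sub_mem_unitary {B : Type*} [Ring B] [StarRing B] [Algebra ℂ B] [StarModule ℂ B]
    {Q Y : B} (hY : IsUnit Y) (hQ : star Q = Q ∨ star Q = -Q)
    (hYQ : Y - star Y = (2 * I) • (Q * Q)) :
    1 - (2 * I) • (Q * Ring.inverse Y * Q) ∈ unitary B := by
  set X := Ring.inverse Y with hX
  have e1 : X * Y = 1 := Ring.inverse_mul_cancel _ hY
  have e2 : Y * X = 1 := Ring.mul_inverse_cancel _ hY
  have e3 : star Y * star X = 1 := by rw [← star_mul, e1, star_one]
  have e4 : star X * star Y = 1 := by rw [← star_mul, e2, star_one]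
  have hc : star (2 * I : ℂ) = -(2 * I) := by simp
  have hstar : star (1 - (2 * I) • (Q * X * Q)) = 1 + (2 * I) • (Q * star X * Q) := by
    rw [star_sub, star_one, star_smul, hc, star_mul, star_mul, neg_smul, sub_neg_eq_add]
    -- `Q` occurs twice, so the sign in `Q* = ± Q` cancels.
    rcases hQ with h | h <;> rw [h] <;> simp only [neg_mul, mul_neg, neg_neg, mul_assoc]
  -- Both identities come from `X*(Y - Y*)X = X* - X = X(Y - Y*)X*`.
  have h1 : (2 * I) • (star X * (Q * Q) * X) = star X - X := by
    rw [← smul_mul_assoc, ← mul_smul_comm, ← hYQ, mul_sub, sub_mul, e4, one_mul, mul_assoc, e2,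
      mul_one]
  have h2 : (2 * I) • (X * (Q * Q) * star X) = star X - X := by
    rw [← smul_mul_assoc, ← mul_smul_comm, ← hYQ, mul_sub, sub_mul, e1, one_mul, mul_assoc, e3,
      mul_one]
  have h1' : (2 * I) • (Q * star X * Q * (Q * X * Q)) = Q * star X * Q - Q * X * Q := by
    have : Q * star X * Q * (Q * X * Q) = Q * (star X * (Q * Q) * X) * Q := by
      simp only [mul_assoc]
    rw [this, ← smul_mul_assoc, ← mul_smul_comm, h1, mul_sub, sub_mul]
  have h2' : (2 * I) • (Q * X * Q * (Q * star X * Q)) = Q * star X * Q - Q * X * Q := by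
    have : Q * X * Q * (Q * star X * Q) = Q * (X * (Q * Q) * star X) * Q := by
      simp only [mul_assoc]
    rw [this, ← smul_mul_assoc, ← mul_smul_comm, h2, mul_sub, sub_mul]
  rw [Unitary.mem_iff, hstar]
  constructor
  · rw [add_mul, one_mul, mul_sub, mul_one, smul_mul_smul_comm, mul_smul (2 * I) (2 * I), h1']
    module
  · rw [mul_add, mul_one, sub_mul, one_mul, smul_mul_smul_comm, mul_smul (2 * I) (2 * I), h2']
    module

/-! ### `S(z)` is in `Y_∞`, and its eigenspaces match those of `M(z)` -/

variable {H : Type*} [NormedAddCommGroup H] [InnerProductSpace ℂ H] [CompleteSpace H]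
  {H₀ : H →ₗ.[ℂ] H} {G : H →ₗ.[ℂ] K} {J : K →L[ℂ] K}

theorem opT_sub_star (H₀ : H →ₗ.[ℂ] H) (G : H →ₗ.[ℂ] K) (z : ℂ) :
    opT H₀ G z - star (opT H₀ G z) = (2 * I) • opB H₀ G z := by
  have h : opT H₀ G z = realPart (opT H₀ G z) + I • opB H₀ G z :=
    (realPart_add_I_smul_imaginaryPart _).symm
  have hr : star (realPart (opT H₀ G z) : K →L[ℂ] K) = realPart (opT H₀ G z) :=
    (realPart (opT H₀ G z)).2
  have hi : star (opB H₀ G z) = opB H₀ G z := (imaginaryPart (opT H₀ G z)).2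
  have hs : star (opT H₀ G z) = realPart (opT H₀ G z) - I • opB H₀ G z := by
    nth_rewrite 1 [h]
    rw [star_add, star_smul, hr, hi, Complex.star_def, Complex.conj_I, neg_smul, sub_eq_add_neg]
  rw [hs]
  nth_rewrite 1 [h]
  module

/-- `Im T(z) = Im z · (G (H₀ - z̄)⁻¹) (G (H₀ - z̄)⁻¹)*`. -/
theorem opB_eq (hH : IsSelfAdjoint H₀) (G : H →ₗ.[ℂ] K) {z : ℂ} (hz : z.im ≠ 0) :
    opB H₀ G z = (z.im : ℂ) • (opGRes H₀ G (starRingEnd ℂ z) ∘L opResG H₀ G z) := by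
  have h1 := opT_sub_star H₀ G z
  rw [star_opT hH G hz, ← neg_sub, opT_sub hH G (conj_im_ne_zero hz) hz, ← neg_smul, neg_sub,
    Complex.sub_conj] at h1
  have h2 := congrArg (fun T => (2 * I)⁻¹ • T) h1
  simp only [smul_smul] at h2
  rw [inv_mul_cancel₀ (by simp), one_smul] at h2
  rw [← h2]
  congr 1
  field_simp
  push_cast
  ring

/-- By `opB_eq`, `B(z)` is `Im z` times an operator of the form `LL*`, so `ζ` is `1` in the upper
half-plane and `i` in the lower one. -/
theorem exists_spectrum_opB (hH : IsSelfAdjoint H₀) (G : H →ₗ.[ℂ] K) {z : ℂ} (hz : z.im ≠ 0) :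
    ∃ ζ : ℂ, (ζ = 1 ∨ ζ = I) ∧
      ∀ w ∈ spectrum ℂ (opB H₀ G z), w = ζ ^ 2 * ((|w.re| : ℝ) : ℂ) := by
  have hN : 0 ≤ opGRes H₀ G (starRingEnd ℂ z) ∘L opResG H₀ G z := by
    rw [ContinuousLinearMap.nonneg_iff_isPositive, ← adjoint_opGRes hH G hz]
    exact ContinuousLinearMap.isPositive_self_comp_adjoint _
  have hpos : ∀ r : ℝ, 0 ≤ r →
      0 ≤ (r : ℂ) • (opGRes H₀ G (starRingEnd ℂ z) ∘L opResG H₀ G z) := by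
    intro r hr
    rw [Complex.coe_smul]
    exact smul_nonneg hr hN
  rw [opB_eq hH G hz]
  rcases lt_or_gt_of_ne hz with h | h
  · refine ⟨I, Or.inr rfl, fun w hw => ?_⟩
    have h1 := hpos (-z.im) (by linarith)
    rw [Complex.ofReal_neg, neg_smul] at h1
    have h2 := spectrum_of_nonneg h1 (w := -w) (by rwa [← spectrum.neg_eq, Set.neg_mem_neg])
    rw [Complex.neg_re, abs_neg] at h2
    rw [Complex.I_sq, neg_one_mul, ← h2, neg_neg]
  · refine ⟨1, Or.inl rfl, fun w hw => ?_⟩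
    rw [one_pow, one_mul]
    exact spectrum_of_nonneg (hpos z.im h.le) hw

theorem isStarNormal_opB (H₀ : H →ₗ.[ℂ] H) (G : H →ₗ.[ℂ] K) (z : ℂ) :
    IsStarNormal (opB H₀ G z) :=
  IsSelfAdjoint.isStarNormal (imaginaryPart (opT H₀ G z)).2

theorem Assumptions.isCompactOperator_opSqrt (hA : Assumptions H₀ G J) {z : ℂ} (hz : z.im ≠ 0) :
    IsCompactOperator (opSqrt (opB H₀ G z)) := by
  have := isStarNormal_opB H₀ G z
  obtain ⟨ζ, hζ, hsp⟩ := exists_spectrum_opB hA.selfAdjoint G hz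
  refine SpecFlow.isCompactOperator_opSqrt ?_ hζ hsp
  have h : IsCompactOperator (opGRes H₀ G (starRingEnd ℂ z)) := hA.isCompactOperator_comp _
  rw [opB_eq hA.selfAdjoint G hz]
  exact (h.comp_clm (opResG H₀ G z)).smul (z.im : ℂ)

theorem Assumptions.opS_mem_YInf (hA : Assumptions H₀ G J) {z : ℂ} (hz : z.im ≠ 0) :
    opS H₀ G J z ∈ YInf K := by
  have := isStarNormal_opB H₀ G z
  obtain ⟨ζ, hζ, hsp⟩ := exists_spectrum_opB hA.selfAdjoint G hz
  constructor
  -- With `Y = J⁻¹ + T(z)` the self-adjoint `J⁻¹` drops out of `Y - Y*`, leaving `2i B(z)`.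
  · have h := one_sub_mem_unitary (hA.isUnit_inverse_J_add hz) (star_opSqrt hζ hsp) (by
      rw [opSqrt_mul_self hζ hsp, star_add, hA.inverse_J_self.star_eq, add_sub_add_left_eq_sub,
        opT_sub_star])
    rwa [mul_assoc] at h
  · rw [opS, sub_sub_cancel_left]
    exact (((hA.isCompactOperator_opSqrt hz).comp_clm _).smul (2 * I)).neg

/-- Factors may be commuted without changing eigenspace dimensions at `u - 1 ≠ 0`: pass from `ΓΛ` to
`ΛΓ`, which equals `VQ`, and then to `QV`. -/
theorem Assumptions.finrank_eigenspace_opM (hA : Assumptions H₀ G J) {z : ℂ} (hz : z.im ≠ 0)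
    {u : ℂ} (hu : u ≠ 1) :
    Module.finrank ℂ (Module.End.eigenspace (opM (perturbed H₀ G J) H₀ z : H →ₗ[ℂ] H) u) =
      Module.finrank ℂ (Module.End.eigenspace (opS H₀ G J z : K →ₗ[ℂ] K) u) := by
  have := isStarNormal_opB H₀ G z
  obtain ⟨ζ, hζ, hsp⟩ := exists_spectrum_opB hA.selfAdjoint G hz
  set Q := opSqrt (opB H₀ G z) with hQ
  set X := Ring.inverse (Ring.inverse J + opT H₀ G z) with hX
  set Γ := opResG H₀ G z with hΓ
  set Λ := (starRingEnd ℂ z - z) • (X ∘L opGRes H₀ G (starRingEnd ℂ z)) with hΛ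
  set V := -(2 * I) • (X ∘L Q) with hV
  have hu' : u - 1 ≠ 0 := sub_ne_zero.2 hu
  have hM : (opM (perturbed H₀ G J) H₀ z : H →ₗ[ℂ] H) =
      1 + (Γ : K →ₗ[ℂ] H) ∘ₗ (Λ : H →ₗ[ℂ] K) := by
    rw [hA.opM_eq hz]
    rfl
  have hS : (opS H₀ G J z : K →ₗ[ℂ] K) = 1 + (Q : K →ₗ[ℂ] K) ∘ₗ (V : K →ₗ[ℂ] K) := by
    have : opS H₀ G J z = 1 + Q ∘L V := by
      rw [opS, hV, ContinuousLinearMap.comp_smul, neg_smul, ← sub_eq_add_neg]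
    rw [this]
    rfl
  -- The scalar `z̄ - z = -2i Im z` supplies exactly the factor `Im z` in `B(z)`, so both sides are
  -- `-2i X B(z)`.
  have hVQ : Λ ∘L Γ = V ∘L Q := by
    have h1 : Q ∘L Q = opB H₀ G z := opSqrt_mul_self hζ hsp
    rw [hΛ, hV, ContinuousLinearMap.smul_comp, ContinuousLinearMap.smul_comp,
      ContinuousLinearMap.comp_assoc, ContinuousLinearMap.comp_assoc, h1,
      opB_eq hA.selfAdjoint G hz, ContinuousLinearMap.comp_smul, smul_smul, ← neg_sub,
      Complex.sub_conj]
    congr 1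
    push_cast
    ring
  have hVQ' : (Λ : H →ₗ[ℂ] K) ∘ₗ (Γ : K →ₗ[ℂ] H) = (V : K →ₗ[ℂ] K) ∘ₗ (Q : K →ₗ[ℂ] K) :=
    congrArg (fun T : K →L[ℂ] K => (T : K →ₗ[ℂ] K)) hVQ
  rw [hM, hS, eigenspace_one_add, eigenspace_one_add, finrank_eigenspace_comp_comm _ _ hu', hVQ',
    finrank_eigenspace_comp_comm _ _ hu']

end scattering

end SpecFlow

end

theorem theoremd10 {H K : Type*}
    [NormedAddCommGroup H] [InnerProductSpace ℂ H] [CompleteSpace H]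
    [TopologicalSpace.SeparableSpace H]
    [NormedAddCommGroup K] [InnerProductSpace ℂ K] [CompleteSpace K]
    [TopologicalSpace.SeparableSpace K]
    (H₀ : H →ₗ.[ℂ] H) (G : H →ₗ.[ℂ] K) (J : K →L[ℂ] K) (hA : SpecFlow.Assumptions H₀ G J)
    (z : ℂ) (hz : z.im ≠ 0) :
    IsCompactOperator (SpecFlow.opM (SpecFlow.perturbed H₀ G J) H₀ z - 1 : H →L[ℂ] H) ∧
      ∃ (hM : SpecFlow.opM (SpecFlow.perturbed H₀ G J) H₀ z ∈ SpecFlow.YInf H)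
        (hS : SpecFlow.opS H₀ G J z ∈ SpecFlow.YInf K),
        SpecFlow.etaInf ⟨SpecFlow.opM (SpecFlow.perturbed H₀ G J) H₀ z, hM⟩ =
          SpecFlow.etaInf ⟨SpecFlow.opS H₀ G J z, hS⟩ :=
  ⟨hA.isCompactOperator_opM_sub_one hz, hA.opM_mem_YInf hz, hA.opS_mem_YInf hz,
    SpecFlow.etaInf_eq_of_eigenspaces _ _ fun _ hu => hA.finrank_eigenspace_opM hz hu⟩
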